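/- **Setting.** Let $J=[-\tfrac12,\tfrac12]$. A *dynamic function* on an open interval $\Omega\subseteq\mathbb R$ assigns to each $t\in\Omega$ a function $\varphi(t)(\cdot):J\to\mathbb R$; its one-sided limits $\varphi(t\pm)$ are numbers and are understood uniformly in $s\in J$. $D(\varphi)$ is the set of $t$ at which $\varphi(t)(\cdot)$ is not constant, and $\hat\varphi(t)$ denotes the constant value for $t\notin D(\varphi)$ (the ordinary part). $\mathcal T(\Omega)$ is the space of dynamic functions $\varphi$ with compact support in $\Omega$ such that all $\varphi(t)(\cdot)$ are regulated on $J$ and $\varphi(t+),\varphi(t-)$ exist for all $t\in\Omega$; distributions in $\mathcal T'(\Omega)$ are functionals on $\mathcal T(\Omega)$, and $F\in\mathcal T'(\Omega)$ is non-positive, $F\le 0$, if $(F,\varphi)\le0$ for all $\varphi\in\mathcal T(\Omega)$ with $\varphi\ge0$. The product of $F$ with a dynamic function $p$ is $(pF,\varphi)=(F,p\varphi)$, and a locally integrable $h$ acts by $(h,\varphi)=\int h\hat\varphi\,dt$. The space $s\mathbb{BV}^{\rm loc}(\Omega)$ consists of the dynamic functions $u$ with $u(t)(\cdot)$ absolutely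 continuous on $J$, $u(t)(-\tfrac12)=u(t-)$, $u(t)(\tfrac12)=u(t+)$ for all $t\in\Omega$, with $\hat u$ of locally bounded variation, and with $\sum_{t\in D(u)\cap[c,d]}\operatorname{var}_J u(t)(\cdot)<\infty$ for all $[c,d]\subset\Omega$. Its derivative $\dot u\in\mathcal T'(\Omega)$ is $$(\dot u,\varphi)=\int\hat\varphi\,du_c+\sum_{\tau\in D(u)}\int_J\varphi(\tau)(s)\,\tfrac{d}{ds}u(\tau)(s)\,ds,$$ where $u_c$ is the continuous part of $\hat u$. Vector-valued notions are componentwise. Let $I=(a,\infty)$ with $-\infty\le a$, let $D\subseteq\mathbb R^n$ be open, let $f:D\to\mathbb R^n$ and $g:D\to\mathbb R^{n\times n}$ be Lipschitz, and let $v=\dot u$ with $u\in s\mathbb{BV}^{\rm loc}_n(I)$. A solution of $$\dot x=f(x)+g(x)v\qquad(\ast)$$ on an open interval $\Omega\subseteq I$ is an $x\in s\mathbb{BV}_n^{\rm loc}(\Omega)$ with $x(t)(s)\in D$ for all $t\in\Omega$, $s\in J$, that satisfies $(\ast)$ in $\mathcal T_n'(\Omega)$. A point $x^*\in D$ is an equilibrium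 if $x\equiv x^*$ is a solution of $(\ast)$ on $I$. It is *uniformly stable* for initial times in $S$ if there are closed sets $D\supseteq M_1\supseteq M_2\supseteq\cdots$, each a neighbourhood of $x^*$, such that every neighbourhood of $x^*$ contains some $M_k$, and such that for every $l$ there is $k\ge l$ with the following property: for every $t_0\in S\cap I$ and every solution $x$ of $(\ast)$ on an open interval $\Omega\subseteq I$ containing $t_0$, if $x(t_0-)\in M_k$, then $x$ is viable in $M_l$ from $t_0$ on, that is, $x(t)(s)\in M_l$ for all $s\in J$ and all $t\in\Omega$ with $t\ge t_0$ (so for all $t\ge t_0$, if $x$ is defined on $[t_0,\infty)$). **Theorem 7.** Let $x^*\in D$ be an equilibrium of $(\ast)$, and let $a\le T\le\infty$. Suppose that for every integer $l\ge1$ and every $x\in D$ with Euclidean distance $|x-x^*|_2=1/l$, $$\bigl(x-x^*,\,f(x)+g(x)v\bigr)\le0\quad\text{in }\mathcal T'\bigl((T,\infty)\bigr).$$ Then $x^*$ is uniformly stable for initial times $t_0\in I$, $t_0\ge T$. -/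

import Mathlib

open Set Filter Topology MeasureTheory
open scoped NNReal ENNReal

noncomputable section

namespace DynDist

/-- The interval `J = [-1/2, 1/2]` on which dynamic values are defined. -/
def J : Set ℝ := Icc (-1 / 2) (1 / 2)

/-- A scalar dynamic function `t ↦ φ(t)(·)`; only the values at `s ∈ J` matter. A dynamic function
on an open interval `Ω` is represented by any extension of it, and only `t ∈ Ω` matters. -/
abbrev DynFun := ℝ → ℝ → ℝ

/-- `L` is the right-sided limit `φ(t+)`, uniformly in the dynamic variable. -/
def HasRightLim (φ : DynFun) (t L : ℝ) : Prop :=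
  Tendsto (fun p : ℝ × ℝ => φ p.1 p.2) (𝓝[>] t ×ˢ 𝓟 J) (𝓝 L)

/-- `L` is the left-sided limit `φ(t-)`, uniformly in the dynamic variable. -/
def HasLeftLim (φ : DynFun) (t L : ℝ) : Prop :=
  Tendsto (fun p : ℝ × ℝ => φ p.1 p.2) (𝓝[<] t ×ˢ 𝓟 J) (𝓝 L)

/-- A regulated function on `J`: all one-sided limits exist
(boundedness on the compact interval `J` is a consequence). -/
def IsRegulatedOnJ (h : ℝ → ℝ) : Prop :=
  (∀ s ∈ Ico (-1 / 2 : ℝ) (1 / 2), ∃ L, Tendsto h (𝓝[>] s) (𝓝 L)) ∧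
    ∀ s ∈ Ioc (-1 / 2 : ℝ) (1 / 2), ∃ L, Tendsto h (𝓝[<] s) (𝓝 L)

/-- Dynamic test functions supported in the compact interval `[c, d]`: regulated dynamic functions
that vanish outside `[c, d]` (they are extended by zero to all `t ∈ ℝ`). The dynamic test functions
on an open interval `Ω` are the union of these spaces over all `[c, d] ⊆ Ω`. -/
structure IsTest (c d : ℝ) (φ : DynFun) : Prop where
  regulated : ∀ t, IsRegulatedOnJ (φ t)
  rightLim : ∀ t, ∃ L, HasRightLim φ t L
  leftLim : ∀ t, ∃ L, HasLeftLim φ t L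
  support : ∀ t, t ∉ Icc c d → ∀ s ∈ J, φ t s = 0

/-- The set `D(φ)` of the points at which the dynamic value is not constant. -/
def dynSet (φ : DynFun) : Set ℝ := {t | ∃ s ∈ J, φ t s ≠ φ t (-1 / 2)}

/-- The ordinary part: the constant dynamic value off `D(φ)`. For a regulated dynamic function
`D(φ)` is at most countable, and the ordinary part is only ever integrated against atomless
measures, so that its values on `D(φ)` are irrelevant. For a function with `φ(t)(-1/2) = φ(t-)`
this is the left-continuous representative. -/
def ordPart (φ : DynFun) : ℝ → ℝ := fun t => φ t (-1 / 2)

/-- Dynamic functions of locally bounded variation on the open interval `Ω`: the dynamic values are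
absolutely continuous and join `u(t-)` to `u(t+)`, the ordinary part has locally bounded variation,
and the variations of the dynamic values are summable over compact subintervals. -/
structure IsSBVLoc (Ω : Set ℝ) (u : DynFun) : Prop where
  absCont : ∀ t ∈ Ω, AbsolutelyContinuousOnInterval (u t) (-1 / 2) (1 / 2)
  leftLim : ∀ t ∈ Ω, HasLeftLim u t (u t (-1 / 2))
  rightLim : ∀ t ∈ Ω, HasRightLim u t (u t (1 / 2))
  locallyBV : LocallyBoundedVariationOn (ordPart u) Ω
  sum_lt_top : ∀ c d, Icc c d ⊆ Ω →
    ∑' t : ↥(dynSet u ∩ Icc c d), eVariationOn (u t) J < ∞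

open Classical in
/-- The signed Stieltjes measure `dF` on `[c, d]` of a function `F` of bounded variation on
`[c, d]`: the Stieltjes measure of `F` extended by constants outside `[c, d]`. -/
def bvMeasure (F : ℝ → ℝ) (c d : ℝ) : SignedMeasure ℝ :=
  if h : BoundedVariationOn (fun t => F (max c (min t d))) univ then h.vectorMeasure else 0

/-- Linear functionals on dynamic test functions. `F c d φ` is the value of `F` on a test function
`φ` that is supported in `[c, d]`; for the functionals below it does not depend on the choice
of such an interval `[c, d]`. -/
abbrev DynFunctional := ℝ → ℝ → DynFun → ℝ

/-- The regular distribution `(h, φ) = ∫ h φ̂ dt`. -/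
def regularDist (h : ℝ → ℝ) : DynFunctional := fun c d φ =>
  ∫ t in Icc c d, h t * ordPart φ t

/-- The derivative of a dynamic function `u` of locally bounded variation:
`(u̇, φ) = ∫ φ̂ du_c + ∑_τ ∫_J φ(τ)(s) (d/ds) u(τ)(s) ds`. The measure `du_c` of the continuous part
of `u` is `dû` with its atoms removed, and these all lie in the countable set `D(u)`. -/
def derivDist (u : DynFun) : DynFunctional := fun c d φ =>
  (∫ᵛ t in Icc c d \ dynSet u, ordPart φ t ∂<•(bvMeasure (ordPart u) c d)) +
    ∑' τ : ↥(dynSet u ∩ Icc c d), ∫ s in (-1 / 2 : ℝ)..(1 / 2), φ τ s * deriv (u τ) s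

/-- The product of a dynamic function and a distribution, `(pF, φ) = (F, pφ)`. -/
def mulDist (p : DynFun) (F : DynFunctional) : DynFunctional := fun c d φ =>
  F c d (fun t s => p t s * φ t s)

/-- Equality of two distributions on the open interval `Ω`. -/
def EqIn (Ω : Set ℝ) (F G : DynFunctional) : Prop :=
  ∀ c d φ, Icc c d ⊆ Ω → IsTest c d φ → F c d φ = G c d φ

/-- Non-positivity of a distribution on the open interval `Ω`. -/
def NonposIn (Ω : Set ℝ) (F : DynFunctional) : Prop :=
  ∀ c d φ, Icc c d ⊆ Ω → IsTest c d φ → (∀ t, ∀ s ∈ J, 0 ≤ φ t s) → F c d φ ≤ 0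

/-- Vector-valued dynamic functions. -/
abbrev DynVec (n : ℕ) := ℝ → ℝ → EuclideanSpace ℝ (Fin n)

/-- The components of a vector-valued dynamic function. -/
def comp {n : ℕ} (x : DynVec n) (i : Fin n) : DynFun := fun t s => x t s i

/-- The `i`-th component of the distribution `f(x) + g(x) u̇`, where `x` is a dynamic function. -/
def rhs {n : ℕ} (f : EuclideanSpace ℝ (Fin n) → EuclideanSpace ℝ (Fin n))
    (g : EuclideanSpace ℝ (Fin n) → Matrix (Fin n) (Fin n) ℝ) (u x : DynVec n) (i : Fin n) :
    DynFunctional :=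
  regularDist (fun t => f (x t (-1 / 2)) i) +
    ∑ j, mulDist (fun t s => g (x t s) i j) (derivDist (comp u j))

/-- `x` is a solution on the open interval `Ω` of `ẋ = f(x) + g(x) v`, `v = u̇`. -/
structure IsSolution {n : ℕ} (D : Set (EuclideanSpace ℝ (Fin n)))
    (f : EuclideanSpace ℝ (Fin n) → EuclideanSpace ℝ (Fin n))
    (g : EuclideanSpace ℝ (Fin n) → Matrix (Fin n) (Fin n) ℝ) (u : DynVec n)
    (Ω : Set ℝ) (x : DynVec n) : Prop where
  sbv : ∀ i, IsSBVLoc Ω (comp x i)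
  mem : ∀ t ∈ Ω, ∀ s ∈ J, x t s ∈ D
  eqn : ∀ i, EqIn Ω (derivDist (comp x i)) (rhs f g u x i)

/-- The point `xstar` is an equilibrium point on `I`: the function that is identically equal
to `xstar` is a solution. -/
def IsEquilibrium {n : ℕ} (D : Set (EuclideanSpace ℝ (Fin n)))
    (f : EuclideanSpace ℝ (Fin n) → EuclideanSpace ℝ (Fin n))
    (g : EuclideanSpace ℝ (Fin n) → Matrix (Fin n) (Fin n) ℝ) (u : DynVec n)
    (I : Set ℝ) (xstar : EuclideanSpace ℝ (Fin n)) : Prop :=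
  xstar ∈ D ∧ IsSolution D f g u I (fun _ _ => xstar)

/-- Viability in `M` from the time `t₀` on of a dynamic function on `Ω`: `x(t₀-) ∈ M`, and
`x(t)(s) ∈ M` for all `t ∈ Ω`, `t ≥ t₀`, `s ∈ J`. For functions of locally bounded variation
`x(t₀-) = x(t₀)(-1/2)`. -/
def IsViable {n : ℕ} (M : Set (EuclideanSpace ℝ (Fin n))) (Ω : Set ℝ) (t₀ : ℝ)
    (x : DynVec n) : Prop :=
  x t₀ (-1 / 2) ∈ M ∧ ∀ t ∈ Ω, t₀ ≤ t → ∀ s ∈ J, x t s ∈ M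

/-- Uniform stability of `xstar` with respect to the initial times `t₀ ∈ S`: there is a decreasing
sequence of closed neighbourhoods `M k ⊆ D` of `xstar`, shrinking to `xstar`, such that for each `l`
there is `k ≥ l` for which every solution with `x(t₀-) ∈ M k` is viable in `M l` from `t₀` on, as
long as it is defined (so on `(t₀, ∞)`, if it is defined there). -/
def IsUniformlyStable {n : ℕ} (D : Set (EuclideanSpace ℝ (Fin n)))
    (f : EuclideanSpace ℝ (Fin n) → EuclideanSpace ℝ (Fin n))
    (g : EuclideanSpace ℝ (Fin n) → Matrix (Fin n) (Fin n) ℝ) (u : DynVec n)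
    (I S : Set ℝ) (xstar : EuclideanSpace ℝ (Fin n)) : Prop :=
  ∃ M : ℕ → Set (EuclideanSpace ℝ (Fin n)),
    (∀ k, IsClosed (M k) ∧ M (k + 1) ⊆ M k ∧ M k ⊆ D ∧ M k ∈ 𝓝 xstar) ∧
    (∀ U ∈ 𝓝 xstar, ∃ k, M k ⊆ U) ∧
    ∀ l, ∃ k, l ≤ k ∧ ∀ t₀ ∈ S, ∀ (Ω : Set ℝ) (x : DynVec n),
      IsOpen Ω → Ω.OrdConnected → Ω ⊆ I → t₀ ∈ Ω →
      IsSolution D f g u Ω x → x t₀ (-1 / 2) ∈ M k → IsViable (M l) Ω t₀ x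

/-- The open half-line `(a, ∞)`, `-∞ ≤ a`. -/
def openRay (a : EReal) : Set ℝ := {t | a < (t : EReal)}

/-- The closed half-line of the real `t ≥ a`, `-∞ ≤ a`. -/
def closedRay (a : EReal) : Set ℝ := {t | a ≤ (t : EReal)}

end DynDist

end

noncomputable section

namespace DynDist

/-! Dynamic times `(t, s)` are ordered lexicographically. Testing the equation against the indicator
of the dynamic interval between two such points turns it into an integral equation: by
`IsSBVLoc.derivDist_step` the derivative of `x` returns the increment of `x`, while the right-hand
side is at most a constant times the mass `totFun` of `dt` and all `|du_j|` on that interval. Hence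
a solution is Lipschitz with respect to this mass.

Let `w` be the distance of `x` to a closed ball of radius `r` about `xstar`. On a dynamic interval
of mass `δ` whose later endpoint lies outside the ball, compare the right-hand side along `x` with
the one frozen at the radial projection `y` of that endpoint. The frozen one is non-positive in the
direction `y - xstar`, and the Lipschitz conditions bound the error, so the increment of `w` is at
most `δ * (A * δ + n * K * w)`, with `w` taken at the later endpoint. Parametrising dynamic time by
mass, with each atom traversed continuously along `J`, reduces this to a Grönwall inequality on a
real interval (`lex_gronwall`, `IsSolution.le_mul_exp`). So `w` grows at most exponentially in the
mass, and `w = 0` persists: the ball is viable for initial times after `T`.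

At `t₀ = T` the sign condition says nothing about the jump of `u` at `T`. There the frozen point is
the equilibrium itself, whose frozen right-hand side vanishes, so the jump expands the distance to
`xstar` by at most a factor fixed by `u` (`IsSolution.norm_sub_le_mul_exp`). A smaller initial ball
absorbs this factor. After the jump the ball estimate is applied from times `t' > T` and `t'` tends
to `T` (`IsSolution.norm_sub_le_of_right`). -/

/-! ### Grönwall inequalities on the line and along dynamic time. -/

lemma measureReal_Icc_eq_add {M : Measure ℝ} [IsFiniteMeasure M] {c t : ℝ} (h : c ≤ t) :
    M.real (Icc c t) = M.real (Ico c t) + M.real {t} := by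
  rw [← Ico_union_right h, measureReal_union (by simp) (measurableSet_singleton t)]

/-- The distribution function of a finite measure whose atoms are filled in continuously takes
all intermediate values. -/
lemma exists_filled_distribution_eq {M : Measure ℝ} [IsFiniteMeasure M] {c d : ℝ} (hcd : c ≤ d)
    {l : ℝ → ℝ → ℝ} (hcont : ∀ t ∈ Icc c d, ContinuousOn (l t) J)
    (h0 : ∀ t ∈ Icc c d, l t (-1 / 2) = 0) (h1 : ∀ t ∈ Icc c d, l t (1 / 2) = M.real {t})
    {y : ℝ} (hy0 : 0 ≤ y) (hy : y ≤ M.real (Icc c d)) :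
    ∃ t ∈ Icc c d, ∃ s ∈ J, M.real (Ico c t) + l t s = y := by
  -- At the supremum `τ`, continuity from below gives mass at most `y` on `[c, τ)`, and continuity
  -- from above gives mass at least `y` on `[c, τ]`. Thus `y` lies within the atom at `τ`, where the
  -- intermediate value theorem for `l τ` applies.
  set A : Set ℝ := {t | t ∈ Icc c d ∧ M.real (Ico c t) ≤ y} with hA
  have hcA : c ∈ A := ⟨⟨le_rfl, hcd⟩, by simpa using hy0⟩
  have hbdd : BddAbove A := ⟨d, fun t ht => ht.1.2⟩
  set τ := sSup A with hτ
  have hτm : τ ∈ Icc c d := ⟨le_csSup hbdd hcA, csSup_le ⟨c, hcA⟩ fun t ht => ht.1.2⟩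
  have hlow : M.real (Ico c τ) ≤ y := by
    obtain ⟨v, hvm, hvt, hvA⟩ := exists_seq_tendsto_sSup ⟨c, hcA⟩ hbdd
    have hmono : Monotone fun n => Ico c (v n) := fun i j hij => Ico_subset_Ico_right (hvm hij)
    have hsub : Ico c τ ⊆ ⋃ n, Ico c (v n) := by
      intro z hz
      obtain ⟨n, hn⟩ := (hvt.eventually (lt_mem_nhds hz.2)).exists
      exact mem_iUnion.2 ⟨n, hz.1, hn⟩
    have hle : M (⋃ n, Ico c (v n)) ≤ ENNReal.ofReal y := by
      rw [hmono.measure_iUnion]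
      exact iSup_le fun n =>
        (ENNReal.le_ofReal_iff_toReal_le (measure_ne_top _ _) hy0).2 (hvA n).2
    exact (ENNReal.le_ofReal_iff_toReal_le (measure_ne_top _ _) hy0).1
      ((measure_mono hsub).trans hle)
  have hhigh : y ≤ M.real (Icc c τ) := by
    rcases hτm.2.eq_or_lt with h | h
    · rwa [h]
    · obtain ⟨v, hvm, hvt, hvl⟩ := exists_seq_strictAnti_tendsto' h
      have hlim := tendsto_measure_iInter_atTop (μ := M) (s := fun n => Icc c (v n))
        (fun n => measurableSet_Icc.nullMeasurableSet)
        (fun i j hij => Icc_subset_Icc_right (hvm.antitone hij)) ⟨0, measure_ne_top _ _⟩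
      have hI : ⋂ n, Icc c (v n) = Icc c τ := by
        ext z
        simp only [mem_iInter, mem_Icc]
        refine ⟨fun hz => ⟨(hz 0).1, ge_of_tendsto' hvl fun n => (hz n).2⟩, fun hz n =>
          ⟨hz.1, hz.2.trans (hvt n).1.le⟩⟩
      rw [hI] at hlim
      have hlim' := (ENNReal.tendsto_toReal (measure_ne_top M (Icc c τ))).comp hlim
      refine ge_of_tendsto' hlim' fun n => ?_
      have hnA : v n ∉ A := fun hmem => absurd (le_csSup hbdd hmem) (not_le.2 (hvt n).1)
      have hlt : y < M.real (Ico c (v n)) := by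
        by_contra hcon
        exact hnA ⟨⟨hτm.1.trans (hvt n).1.le, (hvt n).2.le⟩, not_lt.1 hcon⟩
      exact hlt.le.trans (measureReal_mono Ico_subset_Icc_self)
  have hivt := intermediate_value_Icc (a := (-1 / 2 : ℝ)) (b := 1 / 2) (by norm_num)
    (hcont τ hτm)
  rw [h0 τ hτm, h1 τ hτm] at hivt
  rw [measureReal_Icc_eq_add hτm.1] at hhigh
  obtain ⟨s, hs, hse⟩ := hivt ⟨sub_nonneg.2 hlow, sub_le_iff_le_add'.2 hhigh⟩
  exact ⟨τ, hτm, s, hs, by rw [hse]; ring⟩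

/-- A Grönwall inequality for Lipschitz functions with a backward increment estimate. -/
lemma le_mul_exp_of_increment_le {W : ℝ → ℝ} {S A K : ℝ}
    (hlip : ∀ a b, 0 ≤ a → a ≤ b → b ≤ S → |W b - W a| ≤ A * (b - a))
    (hinc : ∀ a b, 0 ≤ a → a ≤ b → b ≤ S → W b - W a ≤ (b - a) * (A * (b - a) + K * W b))
    {b : ℝ} (hb0 : 0 ≤ b) (hbS : b ≤ S) : W b ≤ W 0 * Real.exp (K * b) := by
  have hcont : ContinuousOn W (Icc 0 S) := by
    refine LipschitzOnWith.continuousOn (K := A.toNNReal) ?_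
    refine LipschitzOnWith.of_dist_le_mul fun p hp q hq => ?_
    have hA : A ≤ A.toNNReal := Real.le_coe_toNNReal A
    rw [Real.dist_eq, Real.dist_eq]
    rcases le_total p q with h | h
    · rw [abs_sub_comm, abs_sub_comm p, abs_of_nonneg (sub_nonneg.2 h)]
      exact (hlip p q hp.1 h hq.2).trans
        (mul_le_mul_of_nonneg_right hA (sub_nonneg.2 h))
    · rw [abs_of_nonneg (sub_nonneg.2 h)]
      exact (hlip q p hq.1 h hp.2).trans
        (mul_le_mul_of_nonneg_right hA (sub_nonneg.2 h))
  have hmain := le_gronwallBound_of_liminf_deriv_right_le (f := W) (f' := fun z => K * W z)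
    (δ := W 0) (K := K) (ε := 0) hcont ?_ le_rfl (fun z _ => by simp) b ⟨hb0, hbS⟩
  · simpa [gronwallBound_ε0] using hmain
  -- The increment bound contains `W` at the later endpoint; continuity of `W` makes the bound on
  -- the right difference quotients converge to `K * W z`.
  intro z hz r hr
  have hIoo : Ioo z S ∈ 𝓝[>] z := Ioo_mem_nhdsGT hz.2
  have hWz : Tendsto W (𝓝[>] z) (𝓝 (W z)) :=
    ((hcont z ⟨hz.1, hz.2.le⟩).mono_of_mem_nhdsWithin
      (mem_of_superset hIoo fun q hq => ⟨hz.1.trans hq.1.le, hq.2.le⟩))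
  have hid : Tendsto (fun q : ℝ => q) (𝓝[>] z) (𝓝 z) := tendsto_nhdsWithin_of_tendsto_nhds tendsto_id
  have hlim : Tendsto (fun q => A * (q - z) + K * W q) (𝓝[>] z) (𝓝 (K * W z)) := by
    have := ((hid.sub_const z).const_mul A).add (hWz.const_mul K)
    simpa using this
  refine Eventually.frequently ?_
  filter_upwards [hlim.eventually_lt_const hr, hIoo] with q hq hq'
  have hpos : 0 < q - z := sub_pos.2 hq'.1
  refine lt_of_le_of_lt ?_ hq
  rw [inv_mul_le_iff₀ hpos]
  exact hinc z q hz.1 hq'.1.le hq'.2.le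

/-- The lexicographic order on dynamic times. -/
def LexLE (t₁ s₁ t₂ s₂ : ℝ) : Prop := t₁ < t₂ ∨ t₁ = t₂ ∧ s₁ ≤ s₂

lemma lexLE_total (t₁ s₁ t₂ s₂ : ℝ) : LexLE t₁ s₁ t₂ s₂ ∨ LexLE t₂ s₂ t₁ s₁ := by
  unfold LexLE
  grind

/-- A Grönwall inequality along dynamic time. -/
lemma lex_gronwall {M : Measure ℝ} [IsFiniteMeasure M] {c d : ℝ} (hcd : c ≤ d)
    {l : ℝ → ℝ → ℝ} (hcont : ∀ t ∈ Icc c d, ContinuousOn (l t) J)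
    (h0 : ∀ t ∈ Icc c d, l t (-1 / 2) = 0) (h1 : ∀ t ∈ Icc c d, l t (1 / 2) = M.real {t})
    (hmono : ∀ t ∈ Icc c d, MonotoneOn (l t) J)
    {N : ℝ → ℝ → ℝ} (hN : ∀ t ∈ Icc c d, ∀ s ∈ J, N t s = M.real (Ico c t) + l t s)
    {w : ℝ → ℝ → ℝ} {A K : ℝ} (hA : 0 ≤ A)
    (hlip : ∀ t₁ ∈ Icc c d, ∀ s₁ ∈ J, ∀ t₂ ∈ Icc c d, ∀ s₂ ∈ J, LexLE t₁ s₁ t₂ s₂ →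
      |w t₂ s₂ - w t₁ s₁| ≤ A * (N t₂ s₂ - N t₁ s₁))
    (hinc : ∀ t₁ ∈ Icc c d, ∀ s₁ ∈ J, ∀ t₂ ∈ Icc c d, ∀ s₂ ∈ J, LexLE t₁ s₁ t₂ s₂ →
      w t₂ s₂ - w t₁ s₁ ≤
        (N t₂ s₂ - N t₁ s₁) * (A * (N t₂ s₂ - N t₁ s₁) + K * w t₂ s₂))
    {t : ℝ} (ht : t ∈ Icc c d) {s : ℝ} (hs : s ∈ J) :
    w t s ≤ w c (-1 / 2) * Real.exp (K * N t s) := by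
  have habs : ∀ t₁ ∈ Icc c d, ∀ s₁ ∈ J, ∀ t₂ ∈ Icc c d, ∀ s₂ ∈ J,
      |w t₂ s₂ - w t₁ s₁| ≤ A * |N t₂ s₂ - N t₁ s₁| := by
    intro t₁ ht₁ s₁ hs₁ t₂ ht₂ s₂ hs₂
    rcases lexLE_total t₁ s₁ t₂ s₂ with h | h
    · exact (hlip _ ht₁ _ hs₁ _ ht₂ _ hs₂ h).trans
        (mul_le_mul_of_nonneg_left (le_abs_self _) hA)
    · rw [abs_sub_comm, abs_sub_comm (N t₂ s₂)]
      exact (hlip _ ht₂ _ hs₂ _ ht₁ _ hs₁ h).trans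
        (mul_le_mul_of_nonneg_left (le_abs_self _) hA)
  have hJ0 : (-1 / 2 : ℝ) ∈ J := ⟨le_rfl, by norm_num⟩
  have hJ1 : (1 / 2 : ℝ) ∈ J := ⟨by norm_num, le_rfl⟩
  have hl0 : ∀ t ∈ Icc c d, ∀ s ∈ J, 0 ≤ l t s := fun t ht s hs => by
    rw [← h0 t ht]; exact hmono t ht hJ0 hs hs.1
  have hl1 : ∀ t ∈ Icc c d, ∀ s ∈ J, l t s ≤ M.real {t} := fun t ht s hs => by
    rw [← h1 t ht]; exact hmono t ht hs hJ1 hs.2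
  have hcm : c ∈ Icc c d := ⟨le_rfl, hcd⟩
  have hN0 : N c (-1 / 2) = 0 := by rw [hN c hcm _ hJ0, h0 c hcm]; simp
  have hNnn : ∀ t ∈ Icc c d, ∀ s ∈ J, 0 ≤ N t s := fun t ht s hs => by
    rw [hN t ht s hs]; exact add_nonneg measureReal_nonneg (hl0 t ht s hs)
  have hNle : ∀ t ∈ Icc c d, ∀ s ∈ J, N t s ≤ M.real (Icc c d) := fun t ht s hs => by
    rw [hN t ht s hs]
    refine (add_le_add_right (hl1 t ht s hs) _).trans ?_
    rw [← measureReal_Icc_eq_add ht.1]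
    exact measureReal_mono (Icc_subset_Icc_right ht.2)
  -- A section of `N`: each mass level is attained at some dynamic time. Levels out of range get the
  -- default value `0`.
  have hex : ∀ y : ℝ, ∃ p : ℝ × ℝ, 0 ≤ y → y ≤ M.real (Icc c d) →
      p.1 ∈ Icc c d ∧ p.2 ∈ J ∧ N p.1 p.2 = y := by
    intro y
    by_cases hy : 0 ≤ y ∧ y ≤ M.real (Icc c d)
    · obtain ⟨t, ht, s, hs, he⟩ := exists_filled_distribution_eq hcd hcont h0 h1 hy.1 hy.2
      exact ⟨(t, s), fun _ _ => ⟨ht, hs, by rw [hN t ht s hs, he]⟩⟩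
    · exact ⟨0, fun h h' => absurd ⟨h, h'⟩ hy⟩
  choose p hp using hex
  -- The Lipschitz bound makes `w` equal at points of equal mass, so `w` factors through `N`
  -- whatever section was chosen.
  have hW : ∀ t ∈ Icc c d, ∀ s ∈ J, w t s = w (p (N t s)).1 (p (N t s)).2 := by
    intro t ht s hs
    obtain ⟨h1, h2, h3⟩ := hp (N t s) (hNnn t ht s hs) (hNle t ht s hs)
    have := habs _ h1 _ h2 _ ht _ hs
    rw [h3, sub_self, abs_zero, mul_zero] at this
    exact sub_eq_zero.1 (abs_eq_zero.1 (le_antisymm this (abs_nonneg _)))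
  have hkey := le_mul_exp_of_increment_le (W := fun y => w (p y).1 (p y).2)
    (S := M.real (Icc c d)) (A := A) (K := K) ?_ ?_ (hNnn t ht s hs) (hNle t ht s hs)
  · have hz := hW c hcm _ hJ0
    rw [hN0] at hz
    rw [hW t ht s hs, hz]
    exact hkey
  · intro a b ha hab hb
    obtain ⟨a1, a2, a3⟩ := hp a ha (hab.trans hb)
    obtain ⟨b1, b2, b3⟩ := hp b (ha.trans hab) hb
    have := habs _ a1 _ a2 _ b1 _ b2
    rwa [a3, b3, abs_of_nonneg (sub_nonneg.2 hab)] at this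
  · intro a b ha hab hb
    obtain ⟨a1, a2, a3⟩ := hp a ha (hab.trans hb)
    obtain ⟨b1, b2, b3⟩ := hp b (ha.trans hab) hb
    rcases hab.eq_or_lt with rfl | hlt
    · simp
    rcases lexLE_total (p a).1 (p a).2 (p b).1 (p b).2 with h | h
    · have := hinc _ a1 _ a2 _ b1 _ b2 h
      rwa [a3, b3] at this
    -- Since `N` is monotone in the lexicographic order, a strictly larger mass cannot sit at an
    -- earlier dynamic time.
    · exfalso
      rw [← a3, ← b3, hN _ a1 _ a2, hN _ b1 _ b2] at hlt
      rcases h with h | ⟨h, h'⟩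
      · have e1 := hl1 _ b1 _ b2
        have e2 := hl0 _ a1 _ a2
        have e3 : M.real (Icc c (p b).1) ≤ M.real (Ico c (p a).1) :=
          measureReal_mono fun z hz => ⟨hz.1, hz.2.trans_lt h⟩
        rw [measureReal_Icc_eq_add b1.1] at e3
        linarith
      · have := hmono _ a1 b2 a2 h'
        rw [h] at hlt
        linarith

/-! ### Variation of dynamic values and one-sided limits. -/

/-- The integral of the absolute value of the derivative is at most the variation. -/
lemma integral_abs_deriv_le_eVariationOn {f : ℝ → ℝ} {a b : ℝ} (hab : a ≤ b)
    (hf : AbsolutelyContinuousOnInterval f a b) :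
    ∫ s in a..b, |deriv f s| ≤ (eVariationOn f (Icc a b)).toReal := by
  have hbv : BoundedVariationOn f (Icc a b) := by
    simpa [uIcc_of_le hab] using hf.boundedVariationOn
  have hlbv := hbv.locallyBoundedVariationOn
  have ha : a ∈ Icc a b := ⟨le_rfl, hab⟩
  set V : ℝ → ℝ := variationOnFromTo f (Icc a b) a with hV
  have hVm : MonotoneOn V (Icc a b) := variationOnFromTo.monotoneOn hlbv ha
  have hVm' : MonotoneOn V (uIcc a b) := by rwa [uIcc_of_le hab]
  have hle : ∀ p ∈ Icc a b, ∀ q ∈ Icc a b, p ≤ q → |f q - f p| ≤ V q - V p := by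
    intro p hp q hq hpq
    have h1 := variationOnFromTo.add hlbv ha hp hq
    have h2 : V q - V p = variationOnFromTo f (Icc a b) p q := by
      rw [hV, ← h1]; ring
    rw [h2, variationOnFromTo.eq_of_le _ _ hpq, ← Real.dist_eq, dist_comm]
    have hfin := hlbv p q hp hq
    exact hfin.dist_le ⟨hp, le_rfl, hpq⟩ ⟨hq, hpq, le_rfl⟩
  -- The difference quotients of `f` are dominated by those of its variation function `V`, and both
  -- functions are differentiable almost everywhere.
  have hae : ∀ᵐ s, s ∈ uIoc a b → |deriv f s| ≤ deriv V s := by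
    have hb' : ∀ᵐ s : ℝ, s ≠ b := by simp [ae_iff, measure_singleton]
    filter_upwards [hf.ae_differentiableAt, hVm.ae_differentiableWithinAt_of_mem, hb']
      with s h1 h2 h3 hs
    rw [uIoc_of_le hab] at hs
    have hsI : s ∈ Ioo a b := ⟨hs.1, lt_of_le_of_ne hs.2 h3⟩
    have hsc : s ∈ Icc a b := Ioo_subset_Icc_self hsI
    have hnb : Icc a b ∈ 𝓝 s := Icc_mem_nhds hsI.1 hsI.2
    have hdf := (h1 (by rwa [uIcc_of_le hab])).hasDerivAt
    have hdV := ((h2 hsc).differentiableAt hnb).hasDerivAt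
    rw [hasDerivAt_iff_tendsto_slope] at hdf hdV
    refine le_of_tendsto_of_tendsto hdf.abs hdV ?_
    filter_upwards [mem_nhdsWithin_of_mem_nhds hnb] with q hq
    simp only [slope_def_field, abs_div]
    rcases le_total s q with h | h
    · rw [abs_of_nonneg (sub_nonneg.2 h)]
      exact div_le_div_of_nonneg_right (hle s hsc q hq h) (sub_nonneg.2 h)
    · rw [abs_sub_comm, abs_sub_comm q, abs_of_nonneg (sub_nonneg.2 h), ← neg_sub (V s),
        ← neg_sub s, neg_div_neg_eq]
      exact div_le_div_of_nonneg_right (hle q hq s hsc h) (sub_nonneg.2 h)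
  have hint : ∫ s in a..b, |deriv f s| ≤ ∫ s in a..b, deriv V s := by
    refine intervalIntegral.integral_mono_ae_restrict hab hf.intervalIntegrable_deriv.abs
      hVm'.intervalIntegrable_deriv ?_
    rw [EventuallyLE, ae_restrict_iff' measurableSet_Icc]
    have ha' : ∀ᵐ s : ℝ, s ≠ a := by simp [ae_iff, measure_singleton]
    filter_upwards [hae, ha'] with s hs hsa hm
    exact hs (by rw [uIoc_of_le hab]; exact ⟨lt_of_le_of_ne hm.1 (Ne.symm hsa), hm.2⟩)
  have hVab : V b - V a = (eVariationOn f (Icc a b)).toReal := by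
    simp [hV, variationOnFromTo.self, variationOnFromTo.eq_of_le _ _ hab]
  -- For monotone `V` the integral of the derivative is at most the total increment; absolute
  -- continuity of `V` is not needed.
  have hmem := hVm'.intervalIntegral_deriv_mem_uIcc
  rw [uIcc_of_le (by rw [hVab]; exact ENNReal.toReal_nonneg)] at hmem
  exact hint.trans (hmem.2.trans hVab.le)

lemma neg_half_mem_J : (-1 / 2 : ℝ) ∈ J := ⟨le_rfl, by norm_num⟩

lemma half_mem_J : (1 / 2 : ℝ) ∈ J := ⟨by norm_num, le_rfl⟩

lemma HasLeftLim.tendsto {φ : DynFun} {t L : ℝ} (h : HasLeftLim φ t L) {s : ℝ} (hs : s ∈ J) :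
    Tendsto (fun t' => φ t' s) (𝓝[<] t) (𝓝 L) :=
  Tendsto.comp (g := fun p : ℝ × ℝ => φ p.1 p.2) (f := fun t' => (t', s)) h
    (tendsto_id.prodMk (tendsto_principal.2 (Eventually.of_forall fun _ => hs)))

lemma HasRightLim.tendsto {φ : DynFun} {t L : ℝ} (h : HasRightLim φ t L) {s : ℝ} (hs : s ∈ J) :
    Tendsto (fun t' => φ t' s) (𝓝[>] t) (𝓝 L) :=
  Tendsto.comp (g := fun p : ℝ × ℝ => φ p.1 p.2) (f := fun t' => (t', s)) h
    (tendsto_id.prodMk (tendsto_principal.2 (Eventually.of_forall fun _ => hs)))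

lemma eq_of_notMem_dynSet {φ : DynFun} {t : ℝ} (h : t ∉ dynSet φ) {s : ℝ} (hs : s ∈ J) :
    φ t s = φ t (-1 / 2) := by
  by_contra hne
  exact h ⟨s, hs, hne⟩

lemma deriv_eq_zero_of_notMem_dynSet {φ : DynFun} {t : ℝ} (h : t ∉ dynSet φ) {s : ℝ}
    (hs : s ∈ Ioo (-1 / 2 : ℝ) (1 / 2)) : deriv (φ t) s = 0 := by
  have : φ t =ᶠ[𝓝 s] fun _ => φ t (-1 / 2) := by
    filter_upwards [Icc_mem_nhds hs.1 hs.2] with q hq using eq_of_notMem_dynSet h hq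
  rw [this.deriv_eq, deriv_const]

/-! ### Stieltjes measures of truncated functions. -/

/-- Truncation of a function to `[c, d]`: extension by the boundary values. -/
def clamp (c d : ℝ) (F : ℝ → ℝ) : ℝ → ℝ := fun t => F (max c (min t d))

lemma clamp_of_mem {c d : ℝ} {F : ℝ → ℝ} {t : ℝ} (ht : t ∈ Icc c d) : clamp c d F t = F t := by
  simp [clamp, ht.1, ht.2]

lemma clamp_of_le {c d : ℝ} {F : ℝ → ℝ} {t : ℝ} (ht : t ≤ c) : clamp c d F t = F c := by
  simp [clamp, min_le_of_left_le ht]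

lemma clamp_of_ge {c d : ℝ} (hcd : c ≤ d) {F : ℝ → ℝ} {t : ℝ} (ht : d ≤ t) :
    clamp c d F t = F d := by
  simp [clamp, ht, hcd]

namespace IsSBVLoc

variable {Ω : Set ℝ} {u : DynFun} {c d : ℝ}

lemma integral_abs_deriv_le (h : IsSBVLoc Ω u) {t : ℝ} (ht : t ∈ Ω) :
    ∫ s in (-1 / 2 : ℝ)..(1 / 2), |deriv (u t) s| ≤ (eVariationOn (u t) J).toReal :=
  integral_abs_deriv_le_eVariationOn (by norm_num) (h.absCont t ht)

/-- A non-constant dynamic value has positive variation, and a family with finite sum in `[0, ∞]`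
has countable support. -/
lemma countable_dynSet (h : IsSBVLoc Ω u) (hΩ : Icc c d ⊆ Ω) :
    (dynSet u ∩ Icc c d).Countable := by
  have hs := Summable.countable_support_ennreal (h.sum_lt_top c d hΩ).ne
  have huniv : Function.support
      (fun t : ↥(dynSet u ∩ Icc c d) => eVariationOn (u t) J) = univ := by
    refine eq_univ_of_forall fun t => ?_
    obtain ⟨s, hs, hne⟩ := t.2.1
    intro h0
    have := eVariationOn.edist_le (u t) hs neg_half_mem_J
    rw [show eVariationOn (u t) J = 0 from h0, nonpos_iff_eq_zero, edist_eq_zero] at this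
    exact hne this
  rw [huniv] at hs
  exact countable_univ_iff.1 hs

lemma measurableSet_sdiff (h : IsSBVLoc Ω u) (hΩ : Icc c d ⊆ Ω) :
    MeasurableSet (Icc c d \ dynSet u) := by
  have : Icc c d \ dynSet u = Icc c d \ (dynSet u ∩ Icc c d) := by ext; simp
  rw [this]
  exact measurableSet_Icc.diff (h.countable_dynSet hΩ).measurableSet

lemma summable_integral_abs_deriv (h : IsSBVLoc Ω u) (hΩ : Icc c d ⊆ Ω) :
    Summable fun t : ↥(dynSet u ∩ Icc c d) =>
      ∫ s in (-1 / 2 : ℝ)..(1 / 2), |deriv (u t) s| := by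
  refine Summable.of_nonneg_of_le (fun t => ?_) (fun t => h.integral_abs_deriv_le (hΩ t.2.2))
    (ENNReal.summable_toReal (h.sum_lt_top c d hΩ).ne)
  exact intervalIntegral.integral_nonneg (by norm_num) fun s _ => abs_nonneg _

lemma boundedVariationOn_clamp (h : IsSBVLoc Ω u) (hcd : c ≤ d) (hΩ : Icc c d ⊆ Ω) :
    BoundedVariationOn (clamp c d (ordPart u)) univ := by
  have h1 := h.locallyBV c d (hΩ ⟨le_rfl, hcd⟩) (hΩ ⟨hcd, le_rfl⟩)
  refine ne_top_of_le_ne_top h1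
    (eVariationOn.comp_le_of_monotoneOn (ordPart u) (fun t => max c (min t d)) ?_ ?_)
  · exact fun p _ q _ hpq => max_le_max le_rfl (min_le_min hpq le_rfl)
  · intro p _
    have : max c (min p d) ∈ Icc c d := ⟨le_max_left _ _, max_le hcd (min_le_right _ _)⟩
    exact ⟨hΩ this, this⟩

lemma bvMeasure_eq (h : IsSBVLoc Ω u) (hcd : c ≤ d) (hΩ : Icc c d ⊆ Ω) :
    bvMeasure (ordPart u) c d = (h.boundedVariationOn_clamp hcd hΩ).vectorMeasure := by
  exact dif_pos (h.boundedVariationOn_clamp hcd hΩ)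

lemma leftLim_clamp (h : IsSBVLoc Ω u) (hΩ : Icc c d ⊆ Ω) {t : ℝ} (ht : t ∈ Icc c d) :
    Function.leftLim (clamp c d (ordPart u)) t = u t (-1 / 2) := by
  refine leftLim_eq_of_tendsto ?_
  rcases ht.1.eq_or_lt with rfl | hlt
  · refine tendsto_const_nhds.congr' ?_
    filter_upwards [self_mem_nhdsWithin] with p hp using (clamp_of_le (F := ordPart u) hp.le).symm
  · refine ((h.leftLim t (hΩ ht)).tendsto neg_half_mem_J).congr' ?_
    filter_upwards [Ioo_mem_nhdsLT hlt] with p hp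
    exact (clamp_of_mem (F := ordPart u) ⟨hp.1.le, hp.2.le.trans ht.2⟩).symm

lemma rightLim_clamp (h : IsSBVLoc Ω u) (hΩ : Icc c d ⊆ Ω) {t : ℝ} (ht : t ∈ Ico c d) :
    Function.rightLim (clamp c d (ordPart u)) t = u t (1 / 2) := by
  refine rightLim_eq_of_tendsto ?_
  refine ((h.rightLim t (hΩ (Ico_subset_Icc_self ht))).tendsto neg_half_mem_J).congr' ?_
  filter_upwards [Ioo_mem_nhdsGT ht.2] with p hp
  exact (clamp_of_mem (F := ordPart u) ⟨ht.1.trans hp.1.le, hp.2.le⟩).symm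

/-- The truncation is constant beyond `d`, so its measure does not see a jump of `u` at `d`. -/
lemma rightLim_clamp_right (hcd : c ≤ d) :
    Function.rightLim (clamp c d (ordPart u)) d = u d (-1 / 2) := by
  refine rightLim_eq_of_tendsto ?_
  refine tendsto_const_nhds.congr' ?_
  filter_upwards [self_mem_nhdsWithin] with p hp using (clamp_of_ge (F := ordPart u) hcd (le_of_lt hp)).symm

/-- Intervals closed on the left and open on the right only involve left limits, which are the
values at `s = -1/2`. -/
lemma bvMeasure_Ico (h : IsSBVLoc Ω u) (hΩ : Icc c d ⊆ Ω) {t : ℝ} (ht : t ∈ Icc c d) :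
    bvMeasure (ordPart u) c d (Ico c t) = u t (-1 / 2) - u c (-1 / 2) := by
  have hcd := ht.1.trans ht.2
  rw [h.bvMeasure_eq hcd hΩ, BoundedVariationOn.vectorMeasure_Ico _ ht.1,
    h.leftLim_clamp hΩ ht, h.leftLim_clamp hΩ ⟨le_rfl, hcd⟩]

lemma bvMeasure_singleton (h : IsSBVLoc Ω u) (hΩ : Icc c d ⊆ Ω) {t : ℝ} (ht : t ∈ Ico c d) :
    bvMeasure (ordPart u) c d {t} = u t (1 / 2) - u t (-1 / 2) := by
  have hcd := ht.1.trans ht.2.le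
  rw [h.bvMeasure_eq hcd hΩ, BoundedVariationOn.vectorMeasure_singleton,
    h.leftLim_clamp hΩ (Ico_subset_Icc_self ht), h.rightLim_clamp hΩ ht]

lemma bvMeasure_singleton_eq_zero (h : IsSBVLoc Ω u) (hΩ : Icc c d ⊆ Ω) {t : ℝ}
    (ht : t ∈ Icc c d) (htD : t ∉ dynSet u) : bvMeasure (ordPart u) c d {t} = 0 := by
  rcases ht.2.eq_or_lt with rfl | hlt
  · rw [h.bvMeasure_eq ht.1 hΩ, BoundedVariationOn.vectorMeasure_singleton,
      h.leftLim_clamp hΩ ht, rightLim_clamp_right ht.1, sub_self]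
  · rw [h.bvMeasure_singleton hΩ ⟨ht.1, hlt⟩, eq_of_notMem_dynSet htD half_mem_J, sub_self]

end IsSBVLoc

instance (m : SignedMeasure ℝ) : IsFiniteMeasure m.variation := by
  rw [← SignedMeasure.totalVariation_eq_variation]
  infer_instance

/-- The total variation of the continuous part of `du` on `[c, d]`. -/
def contVar (u : DynFun) (c d : ℝ) : Measure ℝ :=
  (bvMeasure (ordPart u) c d).variation.restrict (Icc c d \ dynSet u)

instance (u : DynFun) (c d : ℝ) : IsFiniteMeasure (contVar u c d) := by
  unfold contVar
  infer_instance

lemma variation_singleton_eq_zero {m : SignedMeasure ℝ} {t : ℝ} (h : m {t} = 0) :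
    m.variation {t} = 0 := by
  rw [VectorMeasure.variation_apply_eq_zero (measurableSet_singleton t)]
  intro A hA _
  rcases subset_singleton_iff_eq.1 hA with rfl | rfl
  · simp
  · exact h

namespace IsSBVLoc

variable {Ω : Set ℝ} {u : DynFun} {c d : ℝ}

lemma contVar_singleton (h : IsSBVLoc Ω u) (hΩ : Icc c d ⊆ Ω) (t : ℝ) :
    contVar u c d {t} = 0 := by
  unfold contVar
  rw [Measure.restrict_apply (measurableSet_singleton t)]
  by_cases ht : t ∈ Icc c d \ dynSet u
  · rw [inter_eq_left.2 (singleton_subset_iff.2 ht)]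
    exact variation_singleton_eq_zero (h.bvMeasure_singleton_eq_zero hΩ ht.1 ht.2)
  · rw [singleton_inter_eq_empty.2 ht, measure_empty]

end IsSBVLoc

/-! ### Indicators of dynamic intervals as test functions. -/

open Classical in
/-- The indicator function of the dynamic interval from `(c, -1/2)` to `(t, s)`. -/
def step (c t s : ℝ) : DynFun := fun t' s' =>
  if c ≤ t' ∧ (t' < t ∨ t' = t ∧ s' < s) then 1 else 0

lemma step_nonneg (c t s t' s' : ℝ) : 0 ≤ step c t s t' s' := by
  unfold step; split_ifs <;> norm_num

lemma step_le_one (c t s t' s' : ℝ) : step c t s t' s' ≤ 1 := by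
  unfold step; split_ifs <;> norm_num

lemma step_mono (c : ℝ) {t₁ s₁ t₂ s₂ : ℝ} (h : LexLE t₁ s₁ t₂ s₂) (t' s' : ℝ) :
    step c t₁ s₁ t' s' ≤ step c t₂ s₂ t' s' := by
  unfold step
  split_ifs with h1 h2 <;> norm_num
  apply h2
  unfold LexLE at h
  grind

lemma IsTest.sub {c d : ℝ} {φ ψ : DynFun} (hφ : IsTest c d φ) (hψ : IsTest c d ψ) :
    IsTest c d (fun t s => φ t s - ψ t s) where
  regulated t := by
    refine ⟨fun s hs => ?_, fun s hs => ?_⟩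
    · obtain ⟨L, hL⟩ := (hφ.regulated t).1 s hs
      obtain ⟨L', hL'⟩ := (hψ.regulated t).1 s hs
      exact ⟨_, hL.sub hL'⟩
    · obtain ⟨L, hL⟩ := (hφ.regulated t).2 s hs
      obtain ⟨L', hL'⟩ := (hψ.regulated t).2 s hs
      exact ⟨_, hL.sub hL'⟩
  rightLim t := by
    obtain ⟨L, hL⟩ := hφ.rightLim t
    obtain ⟨L', hL'⟩ := hψ.rightLim t
    exact ⟨_, Tendsto.sub hL hL'⟩
  leftLim t := by
    obtain ⟨L, hL⟩ := hφ.leftLim t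
    obtain ⟨L', hL'⟩ := hψ.leftLim t
    exact ⟨_, Tendsto.sub hL hL'⟩
  support t ht s hs := by rw [hφ.support t ht s hs, hψ.support t ht s hs, sub_zero]

lemma hasRightLim_of_eventually {φ : DynFun} {t L : ℝ}
    (h : ∀ᶠ t' in 𝓝[>] t, ∀ s, φ t' s = L) : HasRightLim φ t L := by
  refine tendsto_const_nhds.congr' ?_
  filter_upwards [h.prod_inl _] with p hp using (hp p.2).symm

lemma hasLeftLim_of_eventually {φ : DynFun} {t L : ℝ}
    (h : ∀ᶠ t' in 𝓝[<] t, ∀ s, φ t' s = L) : HasLeftLim φ t L := by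
  refine tendsto_const_nhds.congr' ?_
  filter_upwards [h.prod_inl _] with p hp using (hp p.2).symm

/-- Near any time, on either side of it, the indicator is constant in both variables, which gives
the uniform one-sided limits. The variable `s` matters only at the time `t` itself. -/
lemma isTest_step {c d t : ℝ} (ht : t ∈ Icc c d) (s : ℝ) : IsTest c d (step c t s) where
  regulated t' := by
    refine ⟨fun s' _ => ⟨if c ≤ t' ∧ (t' < t ∨ t' = t ∧ s' < s) then 1 else 0, ?_⟩,
      fun s' _ => ⟨if c ≤ t' ∧ (t' < t ∨ t' = t ∧ s' ≤ s) then 1 else 0, ?_⟩⟩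
    · refine tendsto_const_nhds.congr' ?_
      rcases lt_or_ge s' s with h | h
      · filter_upwards [Ioo_mem_nhdsGT h] with q hq
        simp [step, h, hq.2]
      · filter_upwards [self_mem_nhdsWithin] with q hq
        simp [step, not_lt.2 h, not_lt.2 (h.trans (le_of_lt hq))]
    · refine tendsto_const_nhds.congr' ?_
      rcases le_or_gt s' s with h | h
      · filter_upwards [self_mem_nhdsWithin] with q hq
        simp [step, h, lt_of_lt_of_le hq h]
      · filter_upwards [Ioo_mem_nhdsLT h] with q hq
        simp [step, not_le.2 h, not_lt.2 hq.1.le]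
  rightLim t' := by
    refine ⟨if c ≤ t' ∧ t' < t then 1 else 0, hasRightLim_of_eventually ?_⟩
    rcases lt_or_ge t' c with h | h
    · filter_upwards [Ioo_mem_nhdsGT h] with q hq s'
      simp [step, not_le.2 h, not_le.2 hq.2]
    rcases lt_or_ge t' t with h2 | h2
    · filter_upwards [Ioo_mem_nhdsGT h2] with q hq s'
      simp [step, h, h2, h.trans hq.1.le, hq.2]
    · filter_upwards [self_mem_nhdsWithin] with q hq s'
      have hq' : t < q := lt_of_le_of_lt h2 hq
      simp [step, not_lt.2 h2, not_lt.2 hq'.le, hq'.ne']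
  leftLim t' := by
    refine ⟨if c < t' ∧ t' ≤ t then 1 else 0, hasLeftLim_of_eventually ?_⟩
    rcases le_or_gt t' c with h | h
    · filter_upwards [self_mem_nhdsWithin] with q hq s'
      have hq' : q < c := lt_of_lt_of_le hq h
      simp [step, not_lt.2 h, not_le.2 hq']
    rcases le_or_gt t' t with h2 | h2
    · filter_upwards [Ioo_mem_nhdsLT h] with q hq s'
      simp [step, h, h2, hq.1.le, lt_of_lt_of_le hq.2 h2]
    · filter_upwards [Ioo_mem_nhdsLT h2] with q hq s'
      simp [step, not_le.2 h2, not_lt.2 hq.1.le, hq.1.ne']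
  support t' ht' s' _ := by
    unfold step
    rw [if_neg]
    rintro ⟨h1, h2⟩
    exact ht' ⟨h1, by rcases h2 with h2 | h2 <;> linarith [ht.2, h2]⟩

/-! ### Integrable dynamic functions and sums over jumps. -/

/-- Bounded dynamic functions on `[c, d]` with measurable ordinary part and measurable dynamic
values. -/
structure IsNice (c d : ℝ) (ψ : DynFun) : Prop where
  measurable_ord : Measurable ((Icc c d).indicator (ordPart ψ))
  measurable_dyn : ∀ t ∈ Icc c d, Measurable (J.indicator (ψ t))
  bounded : ∃ C, ∀ t ∈ Icc c d, ∀ s ∈ J, |ψ t s| ≤ C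

lemma measurableSet_J : MeasurableSet J := measurableSet_Icc

namespace IsNice

variable {c d : ℝ} {φ ψ : DynFun}

lemma const (a : ℝ) : IsNice c d fun _ _ => a where
  measurable_ord := measurable_const.indicator measurableSet_Icc
  measurable_dyn _ _ := measurable_const.indicator measurableSet_J
  bounded := ⟨|a|, fun _ _ _ _ => le_rfl⟩

lemma sub (hφ : IsNice c d φ) (hψ : IsNice c d ψ) : IsNice c d fun t s => φ t s - ψ t s where
  measurable_ord := by
    have := hφ.measurable_ord.sub hψ.measurable_ord
    rwa [← indicator_sub'] at this
  measurable_dyn t ht := by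
    have := (hφ.measurable_dyn t ht).sub (hψ.measurable_dyn t ht)
    rwa [← indicator_sub'] at this
  bounded := by
    obtain ⟨C, hC⟩ := hφ.bounded
    obtain ⟨C', hC'⟩ := hψ.bounded
    exact ⟨C + C', fun t ht s hs => (abs_sub _ _).trans (add_le_add (hC t ht s hs) (hC' t ht s hs))⟩

lemma mul (hφ : IsNice c d φ) (hψ : IsNice c d ψ) : IsNice c d fun t s => φ t s * ψ t s where
  measurable_ord := by
    have h := indicator_mul (Icc c d) (ordPart φ) (ordPart ψ)
    exact (congrArg Measurable h).mpr (hφ.measurable_ord.mul hψ.measurable_ord)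
  measurable_dyn t ht := by
    have h := indicator_mul J (φ t) (ψ t)
    exact (congrArg Measurable h).mpr ((hφ.measurable_dyn t ht).mul (hψ.measurable_dyn t ht))
  bounded := by
    obtain ⟨C, hC⟩ := hφ.bounded
    obtain ⟨C', hC'⟩ := hψ.bounded
    refine ⟨C * C', fun t ht s hs => ?_⟩
    rw [abs_mul]
    exact mul_le_mul (hC t ht s hs) (hC' t ht s hs) (abs_nonneg _)
      ((abs_nonneg _).trans (hC t ht s hs))

lemma step (t s : ℝ) : IsNice c d (step c t s) where
  measurable_ord := by
    refine Measurable.indicator ?_ measurableSet_Icc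
    refine Measurable.ite ?_ measurable_const measurable_const
    exact measurableSet_Ici.inter (measurableSet_Iio.union
      ((measurableSet_singleton t).inter (MeasurableSet.const _)))
  measurable_dyn t' _ := by
    refine Measurable.indicator ?_ measurableSet_J
    refine Measurable.ite ?_ measurable_const measurable_const
    exact (MeasurableSet.const _).inter ((MeasurableSet.const _).union
      ((MeasurableSet.const _).inter measurableSet_Iio))
  bounded := ⟨1, fun t' _ s' _ => by
    rw [abs_of_nonneg (step_nonneg c t s t' s')]; exact step_le_one c t s t' s'⟩

lemma integrable (hψ : IsNice c d ψ) {μ : Measure ℝ} [IsFiniteMeasure μ] {A : Set ℝ}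
    (hA : MeasurableSet A) (hAI : A ⊆ Icc c d) : Integrable (ordPart ψ) (μ.restrict A) := by
  obtain ⟨C, hC⟩ := hψ.bounded
  have hae : ∀ᵐ t ∂μ.restrict A, t ∈ A := ae_restrict_mem hA
  refine Integrable.of_bound (C := C) ?_ ?_
  · refine hψ.measurable_ord.aestronglyMeasurable.congr ?_
    filter_upwards [hae] with t ht using indicator_of_mem (hAI ht) _
  · filter_upwards [hae] with t ht using hC t (hAI ht) _ neg_half_mem_J

lemma intervalIntegrable (hψ : IsNice c d ψ) {t : ℝ} (ht : t ∈ Icc c d) {k : ℝ → ℝ}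
    (hk : IntervalIntegrable k volume (-1 / 2) (1 / 2)) :
    IntervalIntegrable (fun s => ψ t s * k s) volume (-1 / 2) (1 / 2) := by
  obtain ⟨C, hC⟩ := hψ.bounded
  rw [intervalIntegrable_iff_integrableOn_Ioc_of_le (by norm_num)] at hk ⊢
  have hae : ∀ᵐ s ∂volume.restrict (Ioc (-1 / 2 : ℝ) (1 / 2)), s ∈ Ioc (-1 / 2 : ℝ) (1 / 2) :=
    ae_restrict_mem measurableSet_Ioc
  refine Integrable.bdd_mul (c := C) hk ?_ ?_
  · refine (hψ.measurable_dyn t ht).aestronglyMeasurable.congr ?_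
    filter_upwards [hae] with s hs using indicator_of_mem (Ioc_subset_Icc_self hs) _
  · filter_upwards [hae] with s hs using hC t ht s (Ioc_subset_Icc_self hs)

end IsNice

/-- The sum over the jumps in `[c, d]` of a dynamic function against densities on `J`. -/
def jumpSum (D : Set ℝ) (c d : ℝ) (k : ℝ → ℝ → ℝ) (ψ : DynFun) : ℝ :=
  ∑' τ : ↥(D ∩ Icc c d), ∫ s in (-1 / 2 : ℝ)..(1 / 2), ψ τ s * k τ s

section jumpSum

variable {D : Set ℝ} {c d : ℝ} {k : ℝ → ℝ → ℝ} {φ ψ : DynFun}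

lemma norm_integral_mul_le (hk : ∀ t ∈ Icc c d, IntervalIntegrable (k t) volume (-1 / 2) (1 / 2))
    (hφ : IsNice c d φ) {C : ℝ}
    (hle : ∀ t ∈ Icc c d, ∀ s ∈ J, |ψ t s| ≤ C * φ t s) {t : ℝ} (ht : t ∈ Icc c d) :
    ‖∫ s in (-1 / 2 : ℝ)..(1 / 2), ψ t s * k t s‖ ≤
      C * ∫ s in (-1 / 2 : ℝ)..(1 / 2), φ t s * |k t s| := by
  rw [← intervalIntegral.integral_const_mul]
  refine intervalIntegral.norm_integral_le_of_norm_le (by norm_num) ?_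
    ((hφ.intervalIntegrable ht (hk t ht).abs).const_mul C)
  refine Eventually.of_forall fun s hs => ?_
  rw [norm_mul, Real.norm_eq_abs, Real.norm_eq_abs, ← mul_assoc]
  exact mul_le_mul_of_nonneg_right (hle t ht s (Ioc_subset_Icc_self hs)) (abs_nonneg _)

lemma summable_jumpSum
    (hk : ∀ t ∈ Icc c d, IntervalIntegrable (k t) volume (-1 / 2) (1 / 2))
    (hs : Summable fun τ : ↥(D ∩ Icc c d) => ∫ s in (-1 / 2 : ℝ)..(1 / 2), |k τ s|)
    (hψ : IsNice c d ψ) :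
    Summable fun τ : ↥(D ∩ Icc c d) => ∫ s in (-1 / 2 : ℝ)..(1 / 2), ψ τ s * k τ s := by
  obtain ⟨C, hC⟩ := hψ.bounded
  refine Summable.of_norm_bounded (hs.mul_left C) fun τ => ?_
  have := norm_integral_mul_le (ψ := ψ) (φ := fun _ _ => 1) hk (IsNice.const 1) (C := C)
    (fun t ht s hs => by simpa using hC t ht s hs) τ.2.2
  simpa using this

lemma jumpSum_sub
    (hk : ∀ t ∈ Icc c d, IntervalIntegrable (k t) volume (-1 / 2) (1 / 2))
    (hs : Summable fun τ : ↥(D ∩ Icc c d) => ∫ s in (-1 / 2 : ℝ)..(1 / 2), |k τ s|)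
    (hφ : IsNice c d φ) (hψ : IsNice c d ψ) :
    jumpSum D c d k (fun t s => φ t s - ψ t s) = jumpSum D c d k φ - jumpSum D c d k ψ := by
  unfold jumpSum
  rw [← (summable_jumpSum hk hs hφ).tsum_sub (summable_jumpSum hk hs hψ)]
  refine tsum_congr fun τ => ?_
  rw [← intervalIntegral.integral_sub (hφ.intervalIntegrable τ.2.2 (hk τ τ.2.2))
    (hψ.intervalIntegrable τ.2.2 (hk τ τ.2.2))]
  simp only [sub_mul]

lemma abs_jumpSum_le
    (hk : ∀ t ∈ Icc c d, IntervalIntegrable (k t) volume (-1 / 2) (1 / 2))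
    (hs : Summable fun τ : ↥(D ∩ Icc c d) => ∫ s in (-1 / 2 : ℝ)..(1 / 2), |k τ s|)
    (hφ : IsNice c d φ) {C : ℝ} (hle : ∀ t ∈ Icc c d, ∀ s ∈ J, |ψ t s| ≤ C * φ t s) :
    |jumpSum D c d k ψ| ≤ C * jumpSum D c d (fun t s => |k t s|) φ := by
  have hs' := (summable_jumpSum (k := fun t s => |k t s|) (fun t ht => (hk t ht).abs)
    (by simpa using hs) hφ).mul_left C
  have hle' := fun τ : ↥(D ∩ Icc c d) => norm_integral_mul_le (ψ := ψ) hk hφ hle τ.2.2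
  unfold jumpSum
  rw [← tsum_mul_left, ← Real.norm_eq_abs]
  exact tsum_of_norm_bounded hs'.hasSum hle'

lemma integral_step_mul {t s : ℝ} (hs : s ∈ J) {τ : ℝ} (hτ : c ≤ τ)
    (hk : IntervalIntegrable (k τ) volume (-1 / 2) (1 / 2)) :
    ∫ s' in (-1 / 2 : ℝ)..(1 / 2), step c t s τ s' * k τ s' =
      if τ < t then ∫ s' in (-1 / 2 : ℝ)..(1 / 2), k τ s' else
        if τ = t then ∫ s' in (-1 / 2 : ℝ)..s, k t s' else 0 := by
  split_ifs with h1 h2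
  · simp [step, hτ, h1]
  · subst h2
    have h0 : ∀ s' : ℝ, step c τ s τ s' * k τ s' = (Iio s).indicator (k τ) s' := by
      intro s'
      by_cases h : s' < s <;> simp [step, hτ, h]
    simp only [h0]
    have hsub1 : uIcc (-1 / 2) s ⊆ uIcc (-1 / 2 : ℝ) (1 / 2) := by
      rw [uIcc_of_le hs.1, uIcc_of_le (by norm_num)]; exact Icc_subset_Icc_right hs.2
    have hsub2 : uIcc s (1 / 2) ⊆ uIcc (-1 / 2 : ℝ) (1 / 2) := by
      rw [uIcc_of_le hs.2, uIcc_of_le (by norm_num)]; exact Icc_subset_Icc_left hs.1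
    have e1 : (∀ᵐ q : ℝ, q ∈ uIoc (-1 / 2) s → k τ q = (Iio s).indicator (k τ) q) := by
      have hb' : ∀ᵐ q : ℝ, q ≠ s := by simp [ae_iff, measure_singleton]
      filter_upwards [hb'] with q hq hm
      rw [uIoc_of_le hs.1] at hm
      exact (indicator_of_mem (s := Iio s) (lt_of_le_of_ne hm.2 hq) _).symm
    have e2 : ∀ q ∈ uIoc s (1 / 2), (0 : ℝ) = (Iio s).indicator (k τ) q := by
      intro q hm
      rw [uIoc_of_le hs.2] at hm
      exact (indicator_of_notMem (s := Iio s) (not_lt.2 hm.1.le) _).symm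
    rw [← intervalIntegral.integral_add_adjacent_intervals (b := s)
      ((hk.mono_set hsub1).congr_ae ((ae_restrict_iff' measurableSet_uIoc).2 e1))
      ((intervalIntegrable_const (c := (0 : ℝ))).congr e2),
      ← intervalIntegral.integral_congr_ae e1,
      ← intervalIntegral.integral_congr_ae (Eventually.of_forall e2)]
    simp
  · simp [step, h1, h2]

/-- Jumps before `t` enter completely, the one at `t` only up to `s`, later ones not at all. If `t`
is not in `D`, the partial term is zero by `hD`, so the formula needs no case distinction. -/
lemma jumpSum_step {t s : ℝ} (hs : s ∈ J) (ht : t ∈ Icc c d)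
    (hk : ∀ t ∈ Icc c d, IntervalIntegrable (k t) volume (-1 / 2) (1 / 2))
    (hsum : Summable fun τ : ↥(D ∩ Icc c d) => ∫ s in (-1 / 2 : ℝ)..(1 / 2), k τ s)
    (hD : t ∉ D → ∀ s ∈ Ioo (-1 / 2 : ℝ) (1 / 2), k t s = 0) :
    jumpSum D c d k (step c t s) =
      (∑' τ : ↥(D ∩ Icc c d), (Iio t).indicator
        (fun τ => ∫ s in (-1 / 2 : ℝ)..(1 / 2), k τ s) τ) + ∫ s' in (-1 / 2 : ℝ)..s, k t s' := by
  classical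
  set b := ∫ s' in (-1 / 2 : ℝ)..s, k t s' with hb
  have h1 : ∀ τ : ↥(D ∩ Icc c d), ∫ s' in (-1 / 2 : ℝ)..(1 / 2), step c t s τ s' * k τ s' =
      (Iio t).indicator (fun τ => ∫ s in (-1 / 2 : ℝ)..(1 / 2), k τ s) τ +
        if (τ : ℝ) = t then b else 0 := by
    intro τ
    rw [integral_step_mul hs τ.2.2.1 (hk τ τ.2.2)]
    rcases lt_trichotomy (τ : ℝ) t with h | h | h
    · simp [h, h.ne]
    · simp [h, hb]
    · simp [h.ne', not_lt.2 h.le]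
  unfold jumpSum
  rw [tsum_congr h1]
  have hsum1 : Summable fun τ : ↥(D ∩ Icc c d) => (Iio t).indicator
      (fun τ => ∫ s in (-1 / 2 : ℝ)..(1 / 2), k τ s) (τ : ℝ) := by
    refine (hsum.indicator (Subtype.val ⁻¹' Iio t)).congr fun τ => ?_
    simp [indicator_apply]
  by_cases htD : t ∈ D
  · have h2 : ∀ τ : ↥(D ∩ Icc c d), (if (τ : ℝ) = t then b else 0) =
        if τ = ⟨t, htD, ht⟩ then b else 0 := by
      intro τ
      simp [Subtype.ext_iff]
    have h3 : HasSum (fun τ : ↥(D ∩ Icc c d) => if (τ : ℝ) = t then b else 0) b := by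
      simp only [h2]
      exact hasSum_ite_eq _ _
    rw [hsum1.tsum_add h3.summable, h3.tsum_eq]
  · have h3 : b = 0 := by
      rw [hb, intervalIntegral.integral_of_le hs.1]
      have hb' : ∀ᵐ q : ℝ, q ≠ 1 / 2 := by simp [ae_iff, measure_singleton]
      refine integral_eq_zero_of_ae ?_
      rw [EventuallyEq, ae_restrict_iff' measurableSet_Ioc]
      filter_upwards [hb'] with q hq hm
      exact hD htD q ⟨hm.1, lt_of_le_of_ne (hm.2.trans hs.2) hq⟩
    simp [h3]

end jumpSum

/-! ### The derivative functional and its total variation. -/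

namespace IsSBVLoc

variable {Ω : Set ℝ} {u : DynFun} {c d : ℝ} {φ ψ : DynFun}

lemma intervalIntegrable_deriv (h : IsSBVLoc Ω u) (hΩ : Icc c d ⊆ Ω) :
    ∀ t ∈ Icc c d, IntervalIntegrable (deriv (u t)) volume (-1 / 2) (1 / 2) :=
  fun t ht => (h.absCont t (hΩ ht)).intervalIntegrable_deriv

lemma variation_restrict_eq (h : IsSBVLoc Ω u) (hΩ : Icc c d ⊆ Ω) :
    ((bvMeasure (ordPart u) c d).restrict (Icc c d \ dynSet u)).variation = contVar u c d :=
  VectorMeasure.variation_restrict (h.measurableSet_sdiff hΩ)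

lemma integrable_contVar (h : IsSBVLoc Ω u) (hΩ : Icc c d ⊆ Ω) (hψ : IsNice c d ψ) :
    Integrable (ordPart ψ) (contVar u c d) :=
  hψ.integrable (h.measurableSet_sdiff hΩ) sdiff_subset

lemma derivDist_sub (h : IsSBVLoc Ω u) (hΩ : Icc c d ⊆ Ω) (hφ : IsNice c d φ)
    (hψ : IsNice c d ψ) :
    derivDist u c d (fun t s => φ t s - ψ t s) = derivDist u c d φ - derivDist u c d ψ := by
  have h1 := jumpSum_sub (D := dynSet u) (h.intervalIntegrable_deriv hΩ)
    (h.summable_integral_abs_deriv hΩ) hφ hψ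
  have h2 := VectorMeasure.integral_fun_sub
    (μ := (bvMeasure (ordPart u) c d).restrict (Icc c d \ dynSet u))
    (B := (ContinuousLinearMap.lsmul ℝ ℝ).flip) (f := ordPart φ) (g := ordPart ψ)
    (by rw [VectorMeasure.Integrable, h.variation_restrict_eq hΩ]
        exact h.integrable_contVar hΩ hφ)
    (by rw [VectorMeasure.Integrable, h.variation_restrict_eq hΩ]
        exact h.integrable_contVar hΩ hψ)
  unfold jumpSum at h1
  unfold derivDist
  rw [h1]
  refine (congrArg (· + _) h2).trans ?_
  ring

end IsSBVLoc

/-- The pairing of a dynamic function with the total variation of the derivative of `u`. -/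
def varDist (u : DynFun) (c d : ℝ) (φ : DynFun) : ℝ :=
  (∫ t, ordPart φ t ∂contVar u c d) +
    jumpSum (dynSet u) c d (fun t s => |deriv (u t) s|) φ

/-- The measure on `[c, d]` that is the projection of the total variation of the derivative
of `u`. -/
def varMeasure (u : DynFun) (c d : ℝ) : Measure ℝ :=
  contVar u c d + Measure.sum fun τ : ↥(dynSet u ∩ Icc c d) =>
    ENNReal.ofReal (∫ s in (-1 / 2 : ℝ)..(1 / 2), |deriv (u τ) s|) • Measure.dirac (τ : ℝ)

/-- The total variation of the derivative of `u` on the dynamic interval from `(c, -1/2)`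
to `(t, s)`. -/
def varFun (u : DynFun) (c d t s : ℝ) : ℝ :=
  (varMeasure u c d).real (Ico c t) + ∫ s' in (-1 / 2 : ℝ)..s, |deriv (u t) s'|

lemma integral_abs_nonneg (k : ℝ → ℝ) : 0 ≤ ∫ s in (-1 / 2 : ℝ)..(1 / 2), |k s| :=
  intervalIntegral.integral_nonneg (by norm_num) fun _ _ => abs_nonneg _

/-- The ordinary part of the indicator depends on `s` only at `t`, a null point. -/
lemma ordPart_step_ae {μ : Measure ℝ} {c t s : ℝ} (hμ : μ {t} = 0) :
    ordPart (step c t s) =ᵐ[μ] (Ico c t).indicator fun _ => (1 : ℝ) := by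
  have : ∀ᵐ q ∂μ, q ≠ t := by simpa [ae_iff] using hμ
  filter_upwards [this] with q hq
  simp [ordPart, step, indicator_apply, hq]

namespace IsSBVLoc

variable {Ω : Set ℝ} {u : DynFun} {c d : ℝ} {φ ψ : DynFun}

lemma varDist_sub (h : IsSBVLoc Ω u) (hΩ : Icc c d ⊆ Ω) (hφ : IsNice c d φ)
    (hψ : IsNice c d ψ) :
    varDist u c d (fun t s => φ t s - ψ t s) = varDist u c d φ - varDist u c d ψ := by
  unfold varDist
  rw [jumpSum_sub (fun t ht => (h.intervalIntegrable_deriv hΩ t ht).abs)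
    (by simpa using h.summable_integral_abs_deriv hΩ) hφ hψ]
  have := integral_sub (h.integrable_contVar hΩ hφ) (h.integrable_contVar hΩ hψ)
  refine (congrArg (· + _) this).trans ?_
  ring

/-- The total variation dominates the signed functional on the continuous part and on the jumps
separately. This is the basic estimate of the proof. -/
lemma abs_derivDist_le (h : IsSBVLoc Ω u) (hΩ : Icc c d ⊆ Ω) (hφ : IsNice c d φ) {C : ℝ}
    (hle : ∀ t ∈ Icc c d, ∀ s ∈ J, |ψ t s| ≤ C * φ t s) :
    |derivDist u c d ψ| ≤ C * varDist u c d φ := by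
  have h1 := abs_jumpSum_le (D := dynSet u) (h.intervalIntegrable_deriv hΩ)
    (h.summable_integral_abs_deriv hΩ) hφ hle
  have h2 := VectorMeasure.norm_integral_le_integral_norm
    (μ := (bvMeasure (ordPart u) c d).restrict (Icc c d \ dynSet u))
    (B := (ContinuousLinearMap.lsmul ℝ ℝ (E := ℝ)).flip) (f := ordPart ψ)
  rw [h.variation_restrict_eq hΩ] at h2
  have h3 : ‖(ContinuousLinearMap.lsmul ℝ ℝ (E := ℝ)).flip‖ ≤ 1 := by
    rw [ContinuousLinearMap.opNorm_flip]
    exact ContinuousLinearMap.opNorm_lsmul_le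
  have h4 : ∫ t, ‖ordPart ψ t‖ ∂contVar u c d ≤ C * ∫ t, ordPart φ t ∂contVar u c d := by
    rw [← integral_const_mul]
    refine integral_mono_of_nonneg (Eventually.of_forall fun _ => norm_nonneg _)
      ((h.integrable_contVar hΩ hφ).const_mul C) ?_
    filter_upwards [ae_restrict_mem (h.measurableSet_sdiff hΩ)] with t ht
    exact hle t ht.1 _ neg_half_mem_J
  have h5 := h2.trans (mul_le_of_le_one_left (integral_nonneg fun _ => norm_nonneg _) h3)
  unfold derivDist varDist
  rw [mul_add]
  exact (abs_add_le _ _).trans (add_le_add (h5.trans h4) h1)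

lemma isFiniteMeasure_varMeasure (h : IsSBVLoc Ω u) (hΩ : Icc c d ⊆ Ω) :
    IsFiniteMeasure (varMeasure u c d) := by
  refine ⟨?_⟩
  unfold varMeasure
  rw [Measure.add_apply, Measure.sum_apply _ MeasurableSet.univ]
  refine ENNReal.add_lt_top.2 ⟨measure_lt_top _ _, ?_⟩
  simp only [Measure.smul_apply, measure_univ, smul_eq_mul, mul_one]
  rw [← ENNReal.ofReal_tsum_of_nonneg (fun _ => integral_abs_nonneg _)
    (h.summable_integral_abs_deriv hΩ)]
  exact ENNReal.ofReal_lt_top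

lemma varMeasure_real (h : IsSBVLoc Ω u) (hΩ : Icc c d ⊆ Ω) {A : Set ℝ}
    (hA : MeasurableSet A) : (varMeasure u c d).real A = (contVar u c d).real A +
      ∑' τ : ↥(dynSet u ∩ Icc c d), A.indicator
        (fun τ => ∫ s in (-1 / 2 : ℝ)..(1 / 2), |deriv (u τ) s|) τ := by
  have h1 : ∀ τ : ↥(dynSet u ∩ Icc c d),
      (ENNReal.ofReal (∫ s in (-1 / 2 : ℝ)..(1 / 2), |deriv (u τ) s|) •
        Measure.dirac (τ : ℝ)) A = ENNReal.ofReal (A.indicator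
          (fun τ => ∫ s in (-1 / 2 : ℝ)..(1 / 2), |deriv (u τ) s|) τ) := by
    intro τ
    rw [Measure.smul_apply, Measure.dirac_apply' _ hA]
    by_cases hτ : (τ : ℝ) ∈ A <;> simp [hτ]
  have hsum : Summable fun τ : ↥(dynSet u ∩ Icc c d) => A.indicator
      (fun τ => ∫ s in (-1 / 2 : ℝ)..(1 / 2), |deriv (u τ) s|) (τ : ℝ) := by
    classical
    refine ((h.summable_integral_abs_deriv hΩ).indicator (Subtype.val ⁻¹' A)).congr fun τ => ?_
    simp [indicator_apply]
  have hnn : ∀ τ : ↥(dynSet u ∩ Icc c d), 0 ≤ A.indicator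
      (fun τ => ∫ s in (-1 / 2 : ℝ)..(1 / 2), |deriv (u τ) s|) (τ : ℝ) :=
    fun τ => indicator_nonneg (fun _ _ => integral_abs_nonneg _) _
  unfold varMeasure
  rw [measureReal_def, Measure.add_apply, Measure.sum_apply _ hA, tsum_congr h1,
    ← ENNReal.ofReal_tsum_of_nonneg hnn hsum,
    ENNReal.toReal_add (measure_ne_top _ _) ENNReal.ofReal_ne_top,
    ENNReal.toReal_ofReal (tsum_nonneg hnn), measureReal_def]

lemma integral_abs_deriv_eq_zero {t : ℝ} (htD : t ∉ dynSet u) :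
    ∫ s in (-1 / 2 : ℝ)..(1 / 2), |deriv (u t) s| = 0 := by
  rw [intervalIntegral.integral_of_le (by norm_num), integral_Ioc_eq_integral_Ioo]
  refine integral_eq_zero_of_ae ?_
  filter_upwards [ae_restrict_mem measurableSet_Ioo] with q hq
  simp [deriv_eq_zero_of_notMem_dynSet htD hq]

/-- The continuous part has no atoms, so only the jump at `t` contributes. This identity is what
lets the running integral over `J` fill in the atom. -/
lemma varMeasure_singleton (h : IsSBVLoc Ω u) (hΩ : Icc c d ⊆ Ω) {t : ℝ} (ht : t ∈ Icc c d) :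
    (varMeasure u c d).real {t} = ∫ s in (-1 / 2 : ℝ)..(1 / 2), |deriv (u t) s| := by
  classical
  rw [h.varMeasure_real hΩ (measurableSet_singleton t), measureReal_def,
    h.contVar_singleton hΩ, ENNReal.toReal_zero, zero_add]
  by_cases htD : t ∈ dynSet u
  · rw [tsum_eq_single ⟨t, htD, ht⟩]
    · simp
    · intro τ hτ
      exact indicator_of_notMem (s := {t}) (fun hm => hτ (Subtype.ext hm)) _
  · rw [integral_abs_deriv_eq_zero htD]
    refine (tsum_congr fun τ => ?_).trans tsum_zero
    refine indicator_of_notMem (s := {t}) (fun hm => htD ?_) _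
    rw [← mem_singleton_iff.1 hm]
    exact τ.2.1

lemma varDist_step (h : IsSBVLoc Ω u) (hΩ : Icc c d ⊆ Ω) {t s : ℝ} (ht : t ∈ Icc c d)
    (hs : s ∈ J) : varDist u c d (step c t s) = varFun u c d t s := by
  unfold varDist varFun
  rw [jumpSum_step hs ht (fun t ht => (h.intervalIntegrable_deriv hΩ t ht).abs)
    (h.summable_integral_abs_deriv hΩ)
    (fun htD q hq => by simp [deriv_eq_zero_of_notMem_dynSet htD hq]),
    h.varMeasure_real hΩ measurableSet_Ico,
    integral_congr_ae (ordPart_step_ae (h.contVar_singleton hΩ t)),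
    integral_indicator_const _ measurableSet_Ico, smul_eq_mul, mul_one, ← add_assoc]
  congr 2
  refine tsum_congr fun τ => ?_
  simp only [indicator_apply, mem_Iio, mem_Ico, τ.2.2.1, true_and]

lemma contIntegral_step (h : IsSBVLoc Ω u) (hΩ : Icc c d ⊆ Ω) (t s : ℝ) :
    (∫ᵛ t' in Icc c d \ dynSet u, ordPart (step c t s) t' ∂<•(bvMeasure (ordPart u) c d)) =
      bvMeasure (ordPart u) c d ((Icc c d \ dynSet u) ∩ Ico c t) := by
  have hms := h.measurableSet_sdiff hΩ
  have h1 : ordPart (step c t s)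
      =ᵐ[((bvMeasure (ordPart u) c d).restrict (Icc c d \ dynSet u)).variation]
        (Ico c t).indicator fun _ => (1 : ℝ) := by
    rw [h.variation_restrict_eq hΩ]
    exact ordPart_step_ae (h.contVar_singleton hΩ t)
  rw [VectorMeasure.integral_congr_ae h1,
    VectorMeasure.integral_indicator_const _ measurableSet_Ico,
    VectorMeasure.restrict_apply _ hms measurableSet_Ico]
  simp [inter_comm]

/-- The continuous part and the complete jumps together give the Stieltjes measure of `[c, t)`, that
is `u(t-) - u(c-)`; the partial jump at `t` adds `u(t)(s) - u(t-)` by absolute continuity. -/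
lemma derivDist_step (h : IsSBVLoc Ω u) (hΩ : Icc c d ⊆ Ω) {t s : ℝ} (ht : t ∈ Icc c d)
    (hs : s ∈ J) : derivDist u c d (step c t s) = u t s - u c (-1 / 2) := by
  have hint := h.intervalIntegrable_deriv hΩ
  have hac : ∀ τ ∈ Icc c d, ∀ s ∈ J, ∫ q in (-1 / 2 : ℝ)..s, deriv (u τ) q =
      u τ s - u τ (-1 / 2) := by
    intro τ hτ s hs
    refine ((h.absCont τ (hΩ hτ)).mono ?_).integral_deriv_eq_sub
    rw [uIcc_of_le hs.1, uIcc_of_le (by norm_num)]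
    exact Icc_subset_Icc_right hs.2
  have hsum : Summable fun τ : ↥(dynSet u ∩ Icc c d) =>
      ∫ s in (-1 / 2 : ℝ)..(1 / 2), deriv (u τ) s := by
    refine Summable.of_norm_bounded (h.summable_integral_abs_deriv hΩ) fun τ => ?_
    exact intervalIntegral.norm_integral_le_integral_norm (by norm_num)
  have hcount := (h.countable_dynSet hΩ).to_subtype
  have hjump : (∑' τ : ↥(dynSet u ∩ Icc c d), (Iio t).indicator
      (fun τ => ∫ s in (-1 / 2 : ℝ)..(1 / 2), deriv (u τ) s) (τ : ℝ)) =
        bvMeasure (ordPart u) c d (dynSet u ∩ Ico c t) := by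
    -- Cutting every singleton with `Iio t` keeps the index set of the sum over jumps, so countable
    -- additivity matches the two sums term by term.
    have hU : dynSet u ∩ Ico c t = ⋃ τ : ↥(dynSet u ∩ Icc c d), {(τ : ℝ)} ∩ Iio t := by
      ext q
      simp only [mem_inter_iff, mem_Ico, mem_iUnion, mem_singleton_iff, mem_Iio, Subtype.exists,
        mem_Icc]
      constructor
      · rintro ⟨h1, h2, h3⟩
        exact ⟨q, ⟨h1, h2, h3.le.trans ht.2⟩, rfl, h3⟩
      · rintro ⟨a, ⟨h1, h2, _⟩, rfl, h3⟩
        exact ⟨h1, h2, h3⟩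
    rw [hU, VectorMeasure.of_disjoint_iUnion]
    · refine tsum_congr fun τ => ?_
      by_cases hτ : (τ : ℝ) < t
      · rw [indicator_of_mem (show (τ : ℝ) ∈ Iio t from hτ), hac τ τ.2.2 _ half_mem_J,
          inter_eq_left.2 (singleton_subset_iff.2 (show (τ : ℝ) ∈ Iio t from hτ)),
          h.bvMeasure_singleton hΩ ⟨τ.2.2.1, hτ.trans_le ht.2⟩]
      · rw [indicator_of_notMem (show (τ : ℝ) ∉ Iio t from hτ),
          singleton_inter_eq_empty.2 (show (τ : ℝ) ∉ Iio t from hτ), VectorMeasure.empty]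
    · exact fun τ => (measurableSet_singleton _).inter measurableSet_Iio
    · intro p q hpq
      refine Disjoint.mono inter_subset_left inter_subset_left ?_
      exact disjoint_singleton.2 fun he => hpq (Subtype.ext he)
  have hsplit : bvMeasure (ordPart u) c d ((Icc c d \ dynSet u) ∩ Ico c t) +
      bvMeasure (ordPart u) c d (dynSet u ∩ Ico c t) =
        u t (-1 / 2) - u c (-1 / 2) := by
    rw [← h.bvMeasure_Ico hΩ ht, ← VectorMeasure.of_union]
    · congr 1
      ext q
      simp only [mem_union, mem_inter_iff, Set.mem_sdiff, mem_Icc, mem_Ico]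
      have : q < t → q ≤ d := fun hq => hq.le.trans ht.2
      tauto
    · rw [Set.disjoint_left]
      exact fun q hq hq' => hq.1.2 hq'.1
    · exact (h.measurableSet_sdiff hΩ).inter measurableSet_Ico
    · have : dynSet u ∩ Ico c t = (dynSet u ∩ Icc c d) ∩ Ico c t := by
        rw [inter_assoc, inter_eq_right.2 (Ico_subset_Icc_self.trans (Icc_subset_Icc_right ht.2))]
      rw [this]
      exact (h.countable_dynSet hΩ).measurableSet.inter measurableSet_Ico
  have hj := jumpSum_step (D := dynSet u) hs ht hint hsum
    fun htD q hq => deriv_eq_zero_of_notMem_dynSet htD hq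
  unfold jumpSum at hj
  unfold derivDist
  rw [hj, h.contIntegral_step hΩ t s, hjump, ← add_assoc, hsplit, hac t ht s hs]
  ring

end IsSBVLoc

lemma lexLE_of_step_sub_ne_zero {c t₁ s₁ t₂ s₂ t s : ℝ} (ht : c ≤ t)
    (h : step c t₂ s₂ t s - step c t₁ s₁ t s ≠ 0) (hle : LexLE t₁ s₁ t₂ s₂) :
    LexLE t₁ s₁ t s ∧ LexLE t s t₂ s₂ := by
  unfold step at h
  unfold LexLE at *
  grind

namespace IsSBVLoc

variable {Ω : Set ℝ} {u : DynFun} {c d : ℝ} {φ : DynFun}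

/-- The domination estimate for the zero function. -/
lemma varDist_nonneg (h : IsSBVLoc Ω u) (hΩ : Icc c d ⊆ Ω) (hφ : IsNice c d φ)
    (h0 : ∀ t ∈ Icc c d, ∀ s ∈ J, 0 ≤ φ t s) : 0 ≤ varDist u c d φ := by
  have := h.abs_derivDist_le hΩ hφ (ψ := fun _ _ => 0) (C := 1)
    (fun t ht s hs => by simpa using h0 t ht s hs)
  rw [one_mul] at this
  exact (abs_nonneg _).trans this

lemma intervalIntegral_abs_deriv_mono (h : IsSBVLoc Ω u) (hΩ : Icc c d ⊆ Ω) {t : ℝ}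
    (ht : t ∈ Icc c d) :
    MonotoneOn (fun s => ∫ q in (-1 / 2 : ℝ)..s, |deriv (u t) q|) J := by
  intro p hp q hq hpq
  refine intervalIntegral.integral_mono_interval le_rfl hp.1 hpq
    (Eventually.of_forall fun _ => abs_nonneg _) ?_
  refine (h.intervalIntegrable_deriv hΩ t ht).abs.mono_set ?_
  rw [uIcc_of_le hq.1, uIcc_of_le (by norm_num)]
  exact Icc_subset_Icc_right hq.2

lemma continuousOn_intervalIntegral_abs_deriv (h : IsSBVLoc Ω u) (hΩ : Icc c d ⊆ Ω) {t : ℝ}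
    (ht : t ∈ Icc c d) :
    ContinuousOn (fun s => ∫ q in (-1 / 2 : ℝ)..s, |deriv (u t) q|) J := by
  have := ((h.intervalIntegrable_deriv hΩ t ht).abs).absolutelyContinuousOnInterval_intervalIntegral
    (c := -1 / 2) left_mem_uIcc
  have h2 := this.continuousOn
  rwa [uIcc_of_le (by norm_num)] at h2

lemma varFun_le (h : IsSBVLoc Ω u) (hΩ : Icc c d ⊆ Ω) {t s : ℝ} (ht : t ∈ Icc c d)
    (hs : s ∈ J) : varFun u c d t s ≤ (varMeasure u c d).real (Icc c d) := by
  have := h.isFiniteMeasure_varMeasure hΩ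
  refine le_trans ?_ (measureReal_mono (Icc_subset_Icc_right ht.2))
  rw [measureReal_Icc_eq_add ht.1, h.varMeasure_singleton hΩ ht]
  exact add_le_add le_rfl (h.intervalIntegral_abs_deriv_mono hΩ ht hs half_mem_J hs.2)

lemma abs_sub_le_varFun (h : IsSBVLoc Ω u) (hΩ : Icc c d ⊆ Ω) {t s : ℝ} (ht : t ∈ Icc c d)
    (hs : s ∈ J) : |u t s - u c (-1 / 2)| ≤ varFun u c d t s := by
  rw [← h.derivDist_step hΩ ht hs, ← h.varDist_step hΩ ht hs,
    ← one_mul (varDist u c d (step c t s))]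
  refine h.abs_derivDist_le hΩ (IsNice.step t s) fun t' _ s' _ => ?_
  rw [one_mul, abs_of_nonneg (step_nonneg _ _ _ _ _)]

lemma bounded (h : IsSBVLoc Ω u) (hΩ : Icc c d ⊆ Ω) :
    ∃ C, ∀ t ∈ Icc c d, ∀ s ∈ J, |u t s| ≤ C := by
  refine ⟨|u c (-1 / 2)| + (varMeasure u c d).real (Icc c d), fun t ht s hs => ?_⟩
  have h1 := (h.abs_sub_le_varFun hΩ ht hs).trans (h.varFun_le hΩ ht hs)
  have h2 := abs_add_le (u c (-1 / 2)) (u t s - u c (-1 / 2))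
  rw [add_sub_cancel] at h2
  linarith

lemma measurable_clamp (h : IsSBVLoc Ω u) (hcd : c ≤ d) (hΩ : Icc c d ⊆ Ω) :
    Measurable (clamp c d (ordPart u)) := by
  obtain ⟨p, q, hp, hq, he⟩ := (h.boundedVariationOn_clamp hcd
    hΩ).locallyBoundedVariationOn.exists_monotoneOn_sub_monotoneOn
  rw [he]
  exact (monotoneOn_univ.1 hp).measurable.sub (monotoneOn_univ.1 hq).measurable

end IsSBVLoc

/-! ### Pairings with `dt` and `du`, and the total mass. -/

section Vector

variable {n : ℕ} {c d : ℝ}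

/-- The pairing of coefficients `(p, q)` with `(dt, du)`. -/
def pairing (u : DynVec n) (p : DynFun) (q : Fin n → DynFun) : DynFunctional := fun c d φ =>
  (∫ t in Icc c d, ordPart p t * ordPart φ t) +
    ∑ j, derivDist (comp u j) c d fun t s => q j t s * φ t s

lemma rhs_apply (f : EuclideanSpace ℝ (Fin n) → EuclideanSpace ℝ (Fin n))
    (g : EuclideanSpace ℝ (Fin n) → Matrix (Fin n) (Fin n) ℝ) (u x : DynVec n) (i : Fin n)
    (c d : ℝ) (φ : DynFun) :
    rhs f g u x i c d φ =
      pairing u (fun t s => f (x t s) i) (fun j t s => g (x t s) i j) c d φ := by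
  simp [rhs, pairing, regularDist, mulDist, ordPart, Finset.sum_apply]

/-- The pairing of a dynamic function with `dt` and the total variations of `du`. -/
def totDist (u : DynVec n) (c d : ℝ) (φ : DynFun) : ℝ :=
  (∫ t in Icc c d, ordPart φ t) + ∑ j, varDist (comp u j) c d φ

/-- The total mass of `dt` and `|du|` on the dynamic interval from `(c, -1/2)` to `(t, s)`. -/
def totFun (u : DynVec n) (c d t s : ℝ) : ℝ := (t - c) + ∑ j, varFun (comp u j) c d t s

variable {I : Set ℝ} {u : DynVec n}

lemma IsNice.integrableOn {φ : DynFun} (hφ : IsNice c d φ) :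
    Integrable (ordPart φ) (volume.restrict (Icc c d)) := by
  have := hφ.integrable (μ := volume.restrict (Icc c d)) measurableSet_Icc Subset.rfl
  rwa [Measure.restrict_restrict measurableSet_Icc, inter_self] at this

/-- By additivity only the coefficient differences times `φ` remain. They need to be small only
where `φ` does not vanish, which localises the comparison to a short dynamic interval. -/
lemma abs_pairing_sub_le (hu : ∀ j, IsSBVLoc I (comp u j)) (hI : Icc c d ⊆ I) {p p' : DynFun}
    {q q' : Fin n → DynFun} {φ : DynFun} (hp : IsNice c d p) (hp' : IsNice c d p')
    (hq : ∀ j, IsNice c d (q j)) (hq' : ∀ j, IsNice c d (q' j)) (hφ : IsNice c d φ)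
    (h0 : ∀ t ∈ Icc c d, ∀ s ∈ J, 0 ≤ φ t s) {C : ℝ}
    (hpC : ∀ t ∈ Icc c d, ∀ s ∈ J, φ t s ≠ 0 → |p t s - p' t s| ≤ C)
    (hqC : ∀ j, ∀ t ∈ Icc c d, ∀ s ∈ J, φ t s ≠ 0 → |q j t s - q' j t s| ≤ C) :
    |pairing u p q c d φ - pairing u p' q' c d φ| ≤ C * totDist u c d φ := by
  have hmain : ∀ {a b : DynFun} {t s : ℝ}, 0 ≤ φ t s → (φ t s ≠ 0 → |a t s - b t s| ≤ C) →
      |a t s * φ t s - b t s * φ t s| ≤ C * φ t s := by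
    intro a b t s h1 h2
    rw [← sub_mul, abs_mul, abs_of_nonneg h1]
    by_cases hz : φ t s = 0
    · simp [hz]
    · exact mul_le_mul_of_nonneg_right (h2 hz) h1
  have hdiff : pairing u p q c d φ - pairing u p' q' c d φ =
      (∫ t in Icc c d, (ordPart p t * ordPart φ t - ordPart p' t * ordPart φ t)) +
        ∑ j, derivDist (comp u j) c d fun t s => q j t s * φ t s - q' j t s * φ t s := by
    have h1 := integral_sub (hp.mul hφ).integrableOn (hp'.mul hφ).integrableOn
    have h2 : ∀ j, derivDist (comp u j) c d (fun t s => q j t s * φ t s - q' j t s * φ t s) =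
        derivDist (comp u j) c d (fun t s => q j t s * φ t s) -
          derivDist (comp u j) c d (fun t s => q' j t s * φ t s) := fun j =>
      (hu j).derivDist_sub hI ((hq j).mul hφ) ((hq' j).mul hφ)
    simp only [h2, Finset.sum_sub_distrib]
    unfold pairing
    have h1' : ∫ t in Icc c d, (ordPart p t * ordPart φ t - ordPart p' t * ordPart φ t) =
      (∫ t in Icc c d, ordPart p t * ordPart φ t) - ∫ t in Icc c d, ordPart p' t * ordPart φ t := h1
    rw [h1']
    ring
  rw [hdiff]
  unfold totDist
  rw [mul_add, Finset.mul_sum]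
  refine (abs_add_le _ _).trans (add_le_add ?_ ((Finset.abs_sum_le_sum_abs _ _).trans
    (Finset.sum_le_sum fun j _ => ?_)))
  · rw [← integral_const_mul, ← Real.norm_eq_abs]
    refine norm_integral_le_of_norm_le (hφ.integrableOn.const_mul C) ?_
    filter_upwards [ae_restrict_mem measurableSet_Icc] with t ht
    exact hmain (a := p) (b := p') (h0 t ht _ neg_half_mem_J) (hpC t ht _ neg_half_mem_J)
  · exact (hu j).abs_derivDist_le hI hφ fun t ht s hs =>
      hmain (a := q j) (b := q' j) (h0 t ht s hs) (hqC j t ht s hs)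

lemma abs_pairing_le (hu : ∀ j, IsSBVLoc I (comp u j)) (hI : Icc c d ⊆ I) {p : DynFun}
    {q : Fin n → DynFun} {φ : DynFun} (hp : IsNice c d p) (hq : ∀ j, IsNice c d (q j))
    (hφ : IsNice c d φ) (h0 : ∀ t ∈ Icc c d, ∀ s ∈ J, 0 ≤ φ t s) {C : ℝ}
    (hpC : ∀ t ∈ Icc c d, ∀ s ∈ J, |p t s| ≤ C)
    (hqC : ∀ j, ∀ t ∈ Icc c d, ∀ s ∈ J, |q j t s| ≤ C) :
    |pairing u p q c d φ| ≤ C * totDist u c d φ := by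
  have hz : pairing u (fun _ _ => 0) (fun _ _ _ => 0) c d φ = 0 := by
    simp [pairing, ordPart, derivDist]
  have := abs_pairing_sub_le hu hI (p' := fun _ _ => 0) (q' := fun _ _ _ => 0) hp
    (IsNice.const 0) hq (fun _ => IsNice.const 0) hφ h0 (C := C)
    (fun t ht s hs _ => by simpa using hpC t ht s hs)
    (fun j t ht s hs _ => by simpa using hqC j t ht s hs)
  rwa [hz, sub_zero] at this

lemma totDist_sub (hu : ∀ j, IsSBVLoc I (comp u j)) (hI : Icc c d ⊆ I) {φ ψ : DynFun}
    (hφ : IsNice c d φ) (hψ : IsNice c d ψ) :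
    totDist u c d (fun t s => φ t s - ψ t s) = totDist u c d φ - totDist u c d ψ := by
  have h1 : ∫ t in Icc c d, ordPart (fun t s => φ t s - ψ t s) t =
      (∫ t in Icc c d, ordPart φ t) - ∫ t in Icc c d, ordPart ψ t :=
    integral_sub hφ.integrableOn hψ.integrableOn
  unfold totDist
  simp only [fun j => (hu j).varDist_sub hI hφ hψ, Finset.sum_sub_distrib, h1]
  ring

lemma totDist_nonneg (hu : ∀ j, IsSBVLoc I (comp u j)) (hI : Icc c d ⊆ I) {φ : DynFun}
    (hφ : IsNice c d φ) (h0 : ∀ t ∈ Icc c d, ∀ s ∈ J, 0 ≤ φ t s) : 0 ≤ totDist u c d φ :=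
  add_nonneg (setIntegral_nonneg measurableSet_Icc fun t ht => h0 t ht _ neg_half_mem_J)
    (Finset.sum_nonneg fun j _ => (hu j).varDist_nonneg hI hφ h0)

lemma totDist_step (hu : ∀ j, IsSBVLoc I (comp u j)) (hI : Icc c d ⊆ I) {t s : ℝ}
    (ht : t ∈ Icc c d) (hs : s ∈ J) : totDist u c d (step c t s) = totFun u c d t s := by
  unfold totDist totFun
  simp only [fun j => (hu j).varDist_step hI ht hs]
  rw [setIntegral_congr_ae measurableSet_Icc
    ((ordPart_step_ae (μ := volume) (c := c) (s := s) (Real.volume_singleton (a := t))).mono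
      fun _ h _ => h),
    setIntegral_indicator measurableSet_Ico, inter_eq_right.2
      (Ico_subset_Icc_self.trans (Icc_subset_Icc_right ht.2))]
  simp [ht.1]

lemma totDist_step_sub (hu : ∀ j, IsSBVLoc I (comp u j)) (hI : Icc c d ⊆ I) {t₁ s₁ t₂ s₂ : ℝ}
    (ht₁ : t₁ ∈ Icc c d) (hs₁ : s₁ ∈ J) (ht₂ : t₂ ∈ Icc c d) (hs₂ : s₂ ∈ J) :
    totDist u c d (fun t s => step c t₂ s₂ t s - step c t₁ s₁ t s) =
      totFun u c d t₂ s₂ - totFun u c d t₁ s₁ := by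
  rw [totDist_sub hu hI (IsNice.step _ _) (IsNice.step _ _), totDist_step hu hI ht₁ hs₁,
    totDist_step hu hI ht₂ hs₂]

lemma totFun_mono (hu : ∀ j, IsSBVLoc I (comp u j)) (hI : Icc c d ⊆ I) {t₁ s₁ t₂ s₂ : ℝ}
    (ht₁ : t₁ ∈ Icc c d) (hs₁ : s₁ ∈ J) (ht₂ : t₂ ∈ Icc c d) (hs₂ : s₂ ∈ J)
    (h : LexLE t₁ s₁ t₂ s₂) : totFun u c d t₁ s₁ ≤ totFun u c d t₂ s₂ := by
  rw [← sub_nonneg, ← totDist_step_sub hu hI ht₁ hs₁ ht₂ hs₂]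
  exact totDist_nonneg hu hI ((IsNice.step _ _).sub (IsNice.step _ _))
    fun t _ s _ => sub_nonneg.2 (step_mono c h t s)

lemma totFun_le (hu : ∀ j, IsSBVLoc I (comp u j)) (hI : Icc c d ⊆ I) {t s : ℝ}
    (ht : t ∈ Icc c d) (hs : s ∈ J) :
    totFun u c d t s ≤ (d - c) + ∑ j, (varMeasure (comp u j) c d).real (Icc c d) :=
  add_le_add (sub_le_sub_right ht.2 c)
    (Finset.sum_le_sum fun j _ => (hu j).varFun_le hI ht hs)

/-- A Grönwall inequality with respect to `dt` and `|du|`. -/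
lemma totFun_gronwall (hcd : c ≤ d) (hu : ∀ j, IsSBVLoc I (comp u j)) (hI : Icc c d ⊆ I)
    {w : ℝ → ℝ → ℝ} {A K : ℝ} (hA : 0 ≤ A)
    (hlip : ∀ t₁ ∈ Icc c d, ∀ s₁ ∈ J, ∀ t₂ ∈ Icc c d, ∀ s₂ ∈ J, LexLE t₁ s₁ t₂ s₂ →
      |w t₂ s₂ - w t₁ s₁| ≤ A * (totFun u c d t₂ s₂ - totFun u c d t₁ s₁))
    (hinc : ∀ t₁ ∈ Icc c d, ∀ s₁ ∈ J, ∀ t₂ ∈ Icc c d, ∀ s₂ ∈ J, LexLE t₁ s₁ t₂ s₂ →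
      w t₂ s₂ - w t₁ s₁ ≤ (totFun u c d t₂ s₂ - totFun u c d t₁ s₁) *
        (A * (totFun u c d t₂ s₂ - totFun u c d t₁ s₁) + K * w t₂ s₂))
    {t : ℝ} (ht : t ∈ Icc c d) {s : ℝ} (hs : s ∈ J) :
    w t s ≤ w c (-1 / 2) * Real.exp (K * totFun u c d t s) := by
  have hfin := fun j => (hu j).isFiniteMeasure_varMeasure hI
  have hfs : IsFiniteMeasure (∑ j, varMeasure (comp u j) c d) := inferInstance
  have hreal : ∀ A : Set ℝ, (volume.restrict (Icc c d) +
      ∑ j, varMeasure (comp u j) c d).real A = (volume.restrict (Icc c d)).real A +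
        ∑ j, (varMeasure (comp u j) c d).real A := by
    intro A
    rw [measureReal_add_apply]
    congr 1
    simp only [measureReal_def, Measure.finsetSum_apply]
    exact ENNReal.toReal_sum fun j _ => measure_ne_top _ _
  -- Lebesgue measure has no atoms, so the filling of the atoms comes from the jumps of `u` alone.
  refine lex_gronwall (M := volume.restrict (Icc c d) + ∑ j, varMeasure (comp u j) c d) hcd
    (l := fun t s => ∑ j, ∫ q in (-1 / 2 : ℝ)..s, |deriv (comp u j t) q|)
    ?_ ?_ ?_ ?_ ?_ hA hlip hinc ht hs
  · intro t ht
    exact continuousOn_finsetSum _ fun j _ =>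
      (hu j).continuousOn_intervalIntegral_abs_deriv hI ht
  · intro t _
    simp
  · intro t ht
    rw [hreal, measureReal_def, Measure.restrict_apply (measurableSet_singleton t),
      measure_mono_null inter_subset_left Real.volume_singleton, ENNReal.toReal_zero, zero_add]
    exact Finset.sum_congr rfl fun j _ => ((hu j).varMeasure_singleton hI ht).symm
  · intro t ht p hp q hq hpq
    exact Finset.sum_le_sum fun j _ => (hu j).intervalIntegral_abs_deriv_mono hI ht hp hq hpq
  · intro t ht s _
    rw [hreal, measureReal_def, Measure.restrict_apply measurableSet_Ico, inter_eq_left.2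
      (Ico_subset_Icc_self.trans (Icc_subset_Icc_right ht.2)), Real.volume_Ico,
      ENNReal.toReal_ofReal (sub_nonneg.2 ht.1), add_assoc, ← Finset.sum_add_distrib]
    rfl

end Vector

/-! ### Increment estimates along solutions. -/

section Comp

variable {n : ℕ} {c d : ℝ}

lemma IsNice.congr {φ ψ : DynFun} (hφ : IsNice c d φ)
    (h : ∀ t ∈ Icc c d, ∀ s ∈ J, ψ t s = φ t s) : IsNice c d ψ where
  measurable_ord := by
    have : (Icc c d).indicator (ordPart ψ) = (Icc c d).indicator (ordPart φ) :=
      indicator_congr fun t ht => h t ht _ neg_half_mem_J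
    rw [this]
    exact hφ.measurable_ord
  measurable_dyn t ht := by
    have : J.indicator (ψ t) = J.indicator (φ t) := indicator_congr fun s hs => h t ht s hs
    rw [this]
    exact hφ.measurable_dyn t ht
  bounded := by
    obtain ⟨C, hC⟩ := hφ.bounded
    exact ⟨C, fun t ht s hs => by rw [h t ht s hs]; exact hC t ht s hs⟩

lemma norm_le_sum_abs (v : EuclideanSpace ℝ (Fin n)) : ‖v‖ ≤ ∑ i, |v i| := by
  rw [EuclideanSpace.norm_eq]
  refine Real.sqrt_le_iff.2 ⟨Finset.sum_nonneg fun _ _ => abs_nonneg _, ?_⟩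
  exact Finset.sum_sq_le_sq_sum_of_nonneg fun _ _ => abs_nonneg _

lemma abs_apply_le_norm (v : EuclideanSpace ℝ (Fin n)) (i : Fin n) : |v i| ≤ ‖v‖ :=
  PiLp.norm_apply_le v i

/-- The composition of a Lipschitz function with a dynamic function of locally bounded
variation. -/
lemma isNice_lipschitz_comp {Ω : Set ℝ} {x : DynVec n} (hcd : c ≤ d)
    (hx : ∀ i, IsSBVLoc Ω (comp x i)) (hΩ : Icc c d ⊆ Ω) {D : Set (EuclideanSpace ℝ (Fin n))}
    (hmem : ∀ t ∈ Ω, ∀ s ∈ J, x t s ∈ D) {G : EuclideanSpace ℝ (Fin n) → ℝ} {K : ℝ≥0}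
    (hG : LipschitzOnWith K G D) : IsNice c d fun t s => G (x t s) := by
  -- Extending `G` to a Lipschitz function on the whole space gives a continuous `H`, from which
  -- both measurability claims follow.
  obtain ⟨H, hH, hGH⟩ := hG.extend_real
  refine IsNice.congr (φ := fun t s => H (x t s)) ?_ fun t ht s hs => hGH (hmem t (hΩ ht) s hs)
  refine ⟨?_, ?_, ?_⟩
  · have hX : Measurable fun t => (WithLp.toLp 2 fun i => clamp c d (ordPart (comp x i)) t :
        EuclideanSpace ℝ (Fin n)) :=
      (PiLp.continuous_toLp 2 _).measurable.comp
        (measurable_pi_lambda _ fun i => (hx i).measurable_clamp hcd hΩ)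
    have : (Icc c d).indicator (ordPart fun t s => H (x t s)) =
        (Icc c d).indicator fun t => H (WithLp.toLp 2 fun i =>
          clamp c d (ordPart (comp x i)) t) := by
      refine indicator_congr fun t ht => ?_
      have he : x t (-1 / 2) = WithLp.toLp 2 fun i => clamp c d (ordPart (comp x i)) t := by
        ext i
        simp only [clamp_of_mem (F := ordPart (comp x i)) ht]
        rfl
      simp only [ordPart, he]
    rw [this]
    exact (hH.continuous.measurable.comp hX).indicator measurableSet_Icc
  · intro t ht
    have hc : ContinuousOn (fun s => x t s) J := by
      have h1 : ContinuousOn (fun s => fun i => x t s i) J := by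
        refine continuousOn_pi.2 fun i => ?_
        have := ((hx i).absCont t (hΩ ht)).continuousOn
        rwa [uIcc_of_le (by norm_num)] at this
      exact (PiLp.continuous_toLp 2 _).comp_continuousOn h1
    have h2 := hH.continuous.comp_continuousOn hc
    classical
    rw [← piecewise_eq_indicator]
    exact h2.measurable_piecewise continuousOn_const measurableSet_J
  · choose C hC using fun i => (hx i).bounded hΩ
    refine ⟨|H 0| + K * ∑ i, C i, fun t ht s hs => ?_⟩
    have h1 : |H (x t s) - H 0| ≤ K * ‖x t s‖ := by
      have := hH.dist_le_mul (x t s) 0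
      rwa [Real.dist_eq, dist_zero_right] at this
    have h2 : ‖x t s‖ ≤ ∑ i, C i :=
      (norm_le_sum_abs _).trans (Finset.sum_le_sum fun i _ => hC i t ht s hs)
    have h3 := mul_le_mul_of_nonneg_left h2 K.coe_nonneg
    have h4 := abs_add_le (H 0) (H (x t s) - H 0)
    rw [add_sub_cancel] at h4
    linarith

section Solution

variable {D : Set (EuclideanSpace ℝ (Fin n))}
  {f : EuclideanSpace ℝ (Fin n) → EuclideanSpace ℝ (Fin n)}
  {g : EuclideanSpace ℝ (Fin n) → Matrix (Fin n) (Fin n) ℝ} {I Ω : Set ℝ} {u x : DynVec n}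

/-- The integral form of the equation, obtained with the difference of two indicators as test
function. -/
lemma IsSolution.sub_eq_rhs (hx : IsSolution D f g u Ω x) (hΩ : Icc c d ⊆ Ω)
    {t₁ s₁ t₂ s₂ : ℝ} (ht₁ : t₁ ∈ Icc c d) (hs₁ : s₁ ∈ J) (ht₂ : t₂ ∈ Icc c d) (hs₂ : s₂ ∈ J)
    (i : Fin n) :
    x t₂ s₂ i - x t₁ s₁ i =
      rhs f g u x i c d fun t s => step c t₂ s₂ t s - step c t₁ s₁ t s := by
  rw [← hx.eqn i c d _ hΩ ((isTest_step ht₂ s₂).sub (isTest_step ht₁ s₁)),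
    (hx.sbv i).derivDist_sub hΩ (IsNice.step _ _) (IsNice.step _ _),
    (hx.sbv i).derivDist_step hΩ ht₁ hs₁, (hx.sbv i).derivDist_step hΩ ht₂ hs₂]
  simp [comp]

lemma lipschitzOnWith_apply {K : ℝ≥0} (hf : LipschitzOnWith K f D) (i : Fin n) :
    LipschitzOnWith K (fun y => f y i) D := by
  refine LipschitzOnWith.of_dist_le_mul fun p hp q hq => ?_
  refine le_trans ?_ (hf.dist_le_mul p hp q hq)
  rw [Real.dist_eq, dist_eq_norm]
  exact abs_apply_le_norm (f p - f q) i

/-- A solution is Lipschitz with respect to `dt` and `|du|`. -/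
lemma IsSolution.exists_norm_sub_le (hcd : c ≤ d) {K : ℝ≥0} (hf : LipschitzOnWith K f D)
    (hg : ∀ i j, LipschitzOnWith K (fun y => g y i j) D) (hu : ∀ j, IsSBVLoc I (comp u j))
    (hI : Icc c d ⊆ I) (hx : IsSolution D f g u Ω x) (hΩ : Icc c d ⊆ Ω) :
    ∃ A : ℝ, 0 ≤ A ∧ ∀ t₁ ∈ Icc c d, ∀ s₁ ∈ J, ∀ t₂ ∈ Icc c d, ∀ s₂ ∈ J, LexLE t₁ s₁ t₂ s₂ →
      ‖x t₂ s₂ - x t₁ s₁‖ ≤ A * (totFun u c d t₂ s₂ - totFun u c d t₁ s₁) := by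
  have hp := fun i => isNice_lipschitz_comp hcd hx.sbv hΩ hx.mem (lipschitzOnWith_apply hf i)
  have hq := fun i j => isNice_lipschitz_comp hcd hx.sbv hΩ hx.mem (hg i j)
  choose P hP using fun i => (hp i).bounded
  choose Q hQ using fun i j => (hq i j).bounded
  refine ⟨∑ i, (|P i| + ∑ j, |Q i j|), Finset.sum_nonneg fun i _ => add_nonneg (abs_nonneg _)
    (Finset.sum_nonneg fun j _ => abs_nonneg _), fun t₁ ht₁ s₁ hs₁ t₂ ht₂ s₂ hs₂ hle => ?_⟩
  refine (norm_le_sum_abs _).trans ?_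
  rw [Finset.sum_mul]
  refine Finset.sum_le_sum fun i _ => ?_
  rw [PiLp.sub_apply, hx.sub_eq_rhs hΩ ht₁ hs₁ ht₂ hs₂ i, rhs_apply,
    ← totDist_step_sub hu hI ht₁ hs₁ ht₂ hs₂]
  refine abs_pairing_le hu hI (hp i) (hq i) ((IsNice.step _ _).sub (IsNice.step _ _))
    (fun t _ s _ => sub_nonneg.2 (step_mono c hle t s)) (fun t ht s hs => ?_)
    fun j t ht s hs => ?_
  · exact (hP i t ht s hs).trans ((le_abs_self _).trans
      (le_add_of_nonneg_right (Finset.sum_nonneg fun j _ => abs_nonneg _)))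
  · refine (hQ i j t ht s hs).trans ((le_abs_self _).trans ?_)
    refine (Finset.single_le_sum (f := fun j => |Q i j|) (fun j _ => abs_nonneg _)
      (Finset.mem_univ j)).trans (le_add_of_nonneg_left (abs_nonneg _))

/-- The right-hand sides along a solution and at a point differ by a multiple of the distance. -/
lemma IsSolution.abs_rhs_sub_rhs_le (hcd : c ≤ d) {K : ℝ≥0} (hf : LipschitzOnWith K f D)
    (hg : ∀ i j, LipschitzOnWith K (fun y => g y i j) D) (hu : ∀ j, IsSBVLoc I (comp u j))
    (hI : Icc c d ⊆ I) (hx : IsSolution D f g u Ω x) (hΩ : Icc c d ⊆ Ω) {A : ℝ} (hA : 0 ≤ A)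
    (hlip : ∀ t₁ ∈ Icc c d, ∀ s₁ ∈ J, ∀ t₂ ∈ Icc c d, ∀ s₂ ∈ J, LexLE t₁ s₁ t₂ s₂ →
      ‖x t₂ s₂ - x t₁ s₁‖ ≤ A * (totFun u c d t₂ s₂ - totFun u c d t₁ s₁))
    {t₁ s₁ t₂ s₂ : ℝ} (ht₁ : t₁ ∈ Icc c d) (hs₁ : s₁ ∈ J) (ht₂ : t₂ ∈ Icc c d) (hs₂ : s₂ ∈ J)
    (hle : LexLE t₁ s₁ t₂ s₂) {y : EuclideanSpace ℝ (Fin n)} (hy : y ∈ D) (i : Fin n) :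
    |(rhs f g u x i c d fun t s => step c t₂ s₂ t s - step c t₁ s₁ t s) -
      rhs f g u (fun _ _ => y) i c d fun t s => step c t₂ s₂ t s - step c t₁ s₁ t s| ≤
      K * (A * (totFun u c d t₂ s₂ - totFun u c d t₁ s₁) + ‖x t₂ s₂ - y‖) *
        (totFun u c d t₂ s₂ - totFun u c d t₁ s₁) := by
  -- Where the test function is non-zero, `(t, s)` lies between the two endpoints, so `x t s` is
  -- within `A` times the mass of `x t₂ s₂`.
  have hdist : ∀ t ∈ Icc c d, ∀ s ∈ J, step c t₂ s₂ t s - step c t₁ s₁ t s ≠ 0 →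
      dist (x t s) y ≤ A * (totFun u c d t₂ s₂ - totFun u c d t₁ s₁) + ‖x t₂ s₂ - y‖ := by
    intro t ht s hs hne
    obtain ⟨h1, h2⟩ := lexLE_of_step_sub_ne_zero ht.1 hne hle
    have h3 := hlip t ht s hs t₂ ht₂ s₂ hs₂ h2
    have h4 := totFun_mono hu hI ht₁ hs₁ ht hs h1
    have h5 := mul_le_mul_of_nonneg_left
      (sub_le_sub_left h4 (totFun u c d t₂ s₂)) hA
    have h6 := dist_triangle (x t s) (x t₂ s₂) y
    rw [dist_comm (x t s) (x t₂ s₂), dist_eq_norm (x t₂ s₂) (x t s), dist_eq_norm (x t₂ s₂) y] at h6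
    linarith
  rw [rhs_apply, rhs_apply, ← totDist_step_sub hu hI ht₁ hs₁ ht₂ hs₂]
  refine abs_pairing_sub_le hu hI
    (isNice_lipschitz_comp hcd hx.sbv hΩ hx.mem (lipschitzOnWith_apply hf i)) (IsNice.const _)
    (fun j => isNice_lipschitz_comp hcd hx.sbv hΩ hx.mem (hg i j)) (fun j => IsNice.const _)
    ((IsNice.step _ _).sub (IsNice.step _ _))
    (fun t _ s _ => sub_nonneg.2 (step_mono c hle t s)) (fun t ht s hs hne => ?_)
    fun j t ht s hs hne => ?_
  · rw [totDist_step_sub hu hI ht₁ hs₁ ht₂ hs₂, ← Real.dist_eq]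
    exact ((lipschitzOnWith_apply hf i).dist_le_mul _ (hx.mem t (hΩ ht) s hs) y hy).trans
      (mul_le_mul_of_nonneg_left (hdist t ht s hs hne) K.coe_nonneg)
  · rw [totDist_step_sub hu hI ht₁ hs₁ ht₂ hs₂, ← Real.dist_eq]
    exact ((hg i j).dist_le_mul _ (hx.mem t (hΩ ht) s hs) y hy).trans
      (mul_le_mul_of_nonneg_left (hdist t ht s hs hne) K.coe_nonneg)

/-- A Lipschitz functional `w` of a solution whose increments are controlled by non-positive
right-hand sides at points at distance at most `w` grows at most exponentially. -/
lemma IsSolution.le_mul_exp (hcd : c ≤ d) {K : ℝ≥0} (hf : LipschitzOnWith K f D)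
    (hg : ∀ i j, LipschitzOnWith K (fun y => g y i j) D) (hu : ∀ j, IsSBVLoc I (comp u j))
    (hI : Icc c d ⊆ I) (hx : IsSolution D f g u Ω x) (hΩ : Icc c d ⊆ Ω)
    {w : EuclideanSpace ℝ (Fin n) → ℝ} (hw0 : ∀ z, 0 ≤ w z)
    (hw1 : ∀ y z, |w y - w z| ≤ ‖y - z‖)
    (hw : ∀ t₁ ∈ Icc c d, ∀ s₁ ∈ J, ∀ t₂ ∈ Icc c d, ∀ s₂ ∈ J, LexLE t₁ s₁ t₂ s₂ →
      w (x t₂ s₂) = 0 ∨ ∃ y ∈ D, ∃ e : Fin n → ℝ, (∀ i, |e i| ≤ 1) ∧ ‖x t₂ s₂ - y‖ ≤ w (x t₂ s₂) ∧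
        w (x t₂ s₂) - w (x t₁ s₁) ≤ ∑ i, e i * (x t₂ s₂ i - x t₁ s₁ i) ∧
        ∑ i, e i * rhs f g u (fun _ _ => y) i c d
          (fun t s => step c t₂ s₂ t s - step c t₁ s₁ t s) ≤ 0)
    {t : ℝ} (ht : t ∈ Icc c d) {s : ℝ} (hs : s ∈ J) :
    w (x t s) ≤ w (x c (-1 / 2)) * Real.exp (n * K * totFun u c d t s) := by
  obtain ⟨A, hA, hlip⟩ := hx.exists_norm_sub_le hcd hf hg hu hI hΩ
  have hnK : 0 ≤ (n : ℝ) * K := by positivity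
  -- The term `A` serves the Lipschitz bound, and `n * K * A` collects the quadratic freezing error
  -- over the `n` components.
  refine totFun_gronwall hcd hu hI (w := fun t s => w (x t s)) (A := A + n * K * A)
    (by positivity) ?_ ?_ ht hs
  · intro t₁ ht₁ s₁ hs₁ t₂ ht₂ s₂ hs₂ hle
    have h1 := sub_nonneg.2 (totFun_mono hu hI ht₁ hs₁ ht₂ hs₂ hle)
    refine (hw1 _ _).trans ((hlip t₁ ht₁ s₁ hs₁ t₂ ht₂ s₂ hs₂ hle).trans ?_)
    exact mul_le_mul_of_nonneg_right (le_add_of_nonneg_right (by positivity)) h1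
  · intro t₁ ht₁ s₁ hs₁ t₂ ht₂ s₂ hs₂ hle
    set δ := totFun u c d t₂ s₂ - totFun u c d t₁ s₁ with hδ
    have h1 : 0 ≤ δ := sub_nonneg.2 (totFun_mono hu hI ht₁ hs₁ ht₂ hs₂ hle)
    rcases hw t₁ ht₁ s₁ hs₁ t₂ ht₂ s₂ hs₂ hle with h | ⟨y, hy, e, he, hyw, hinc, hneg⟩
    · have h2 : 0 ≤ δ * ((A + n * K * A) * δ) := by positivity
      have h3 := hw0 (x t₁ s₁)
      simp only [h, mul_zero, add_zero]
      linarith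
    · have h2 : ∑ i, e i * (x t₂ s₂ i - x t₁ s₁ i) ≤
          ∑ _i : Fin n, K * (A * δ + w (x t₂ s₂)) * δ := by
        rw [← sub_nonpos, ← Finset.sum_sub_distrib]
        refine le_trans (Finset.sum_le_sum fun i _ => ?_) hneg
        rw [hx.sub_eq_rhs hΩ ht₁ hs₁ ht₂ hs₂ i]
        have h3 := hx.abs_rhs_sub_rhs_le hcd hf hg hu hI hΩ hA hlip ht₁ hs₁ ht₂ hs₂ hle hy i
        rw [← hδ] at h3
        have h4 : K * (A * δ + ‖x t₂ s₂ - y‖) * δ ≤ K * (A * δ + w (x t₂ s₂)) * δ := by gcongr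
        have h5 := (le_abs_self _).trans ((abs_mul (e i) _).le.trans
          (mul_le_of_le_one_left (abs_nonneg _) (he i))) |>.trans (h3.trans h4)
        rw [mul_sub] at h5
        linarith
      rw [Finset.sum_const, Finset.card_univ, Fintype.card_fin, nsmul_eq_mul] at h2
      have h3 : 0 ≤ A * δ * δ := by positivity
      refine (hinc.trans h2).trans ?_
      linarith

end Solution

end Comp

/-! ### Dependence of the total variation on the left endpoint. -/

namespace IsSBVLoc

variable {Ω : Set ℝ} {u : DynFun} {c c' d : ℝ}

lemma rightLim_clamp_eq (h : IsSBVLoc Ω u) (hc : c ≤ c') (hcd : c' ≤ d) (hΩ : Icc c d ⊆ Ω)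
    {t : ℝ} (ht : c' ≤ t) : Function.rightLim (clamp c' d (ordPart u)) t =
      Function.rightLim (clamp c d (ordPart u)) t := by
  refine rightLim_eq_of_tendsto ?_
  refine ((h.boundedVariationOn_clamp (hc.trans hcd) hΩ).tendsto_rightLim t).congr' ?_
  filter_upwards [self_mem_nhdsWithin] with q hq
  have hq' : c' ≤ q := ht.trans (le_of_lt hq)
  simp only [clamp]
  rw [max_eq_right (le_min (hc.trans hq') (hc.trans hcd)), max_eq_right (le_min hq' hcd)]

/-- Intervals `(p, q]` are measured by right limits, and from `c'` on the two truncations have the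
same ones; such intervals form a generating π-system. -/
lemma bvMeasure_restrict_Ioc_eq (h : IsSBVLoc Ω u) (hc : c ≤ c') (hcd : c' ≤ d)
    (hΩ : Icc c d ⊆ Ω) : (bvMeasure (ordPart u) c' d).restrict (Ioc c' d) =
      (bvMeasure (ordPart u) c d).restrict (Ioc c' d) := by
  have hΩ' : Icc c' d ⊆ Ω := (Icc_subset_Icc_left hc).trans hΩ
  have hIoc : ∀ p q, c' ≤ p → bvMeasure (ordPart u) c' d (Ioc p q) =
      bvMeasure (ordPart u) c d (Ioc p q) := by
    intro p q hp
    rcases lt_or_ge q p with hpq | hpq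
    · simp [Ioc_eq_empty (not_lt.2 hpq.le)]
    · rw [h.bvMeasure_eq hcd hΩ', h.bvMeasure_eq (hc.trans hcd) hΩ,
        BoundedVariationOn.vectorMeasure_Ioc _ hpq, BoundedVariationOn.vectorMeasure_Ioc _ hpq,
        h.rightLim_clamp_eq hc hcd hΩ hp, h.rightLim_clamp_eq hc hcd hΩ (hp.trans hpq)]
  refine VectorMeasure.ext_of_generateFrom {S | ∃ p q, p < q ∧ Ioc p q = S} ?_
    ((BorelSpace.measurable_eq (α := ℝ)).trans (borel_eq_generateFrom_Ioc ℝ))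
    (isPiSystem_Ioc id id) ?_
  · rintro _ ⟨p, q, _, rfl⟩
    rw [VectorMeasure.restrict_apply _ measurableSet_Ioc measurableSet_Ioc,
      VectorMeasure.restrict_apply _ measurableSet_Ioc measurableSet_Ioc, Ioc_inter_Ioc]
    exact hIoc _ _ le_sup_right
  · rw [VectorMeasure.restrict_apply _ measurableSet_Ioc MeasurableSet.univ,
      VectorMeasure.restrict_apply _ measurableSet_Ioc MeasurableSet.univ, univ_inter]
    exact hIoc _ _ le_rfl

/-- The measures agree on `(c', d]`, and the point `c'` carries no continuous mass: it is either
removed as a jump or not an atom. -/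
lemma contVar_mono (h : IsSBVLoc Ω u) (hc : c ≤ c') (hcd : c' ≤ d) (hΩ : Icc c d ⊆ Ω) :
    contVar u c' d ≤ contVar u c d := by
  have hΩ' : Icc c' d ⊆ Ω := (Icc_subset_Icc_left hc).trans hΩ
  have hm' := h.measurableSet_sdiff hΩ'
  have hm := h.measurableSet_sdiff hΩ
  rw [← h.variation_restrict_eq hΩ']
  refine VectorMeasure.variation_le_of_forall_enorm_le fun E hE => ?_
  rw [VectorMeasure.restrict_apply _ hm' hE]
  set S := E ∩ (Icc c' d \ dynSet u) with hS
  have hSm : MeasurableSet S := hE.inter hm'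
  have hsplit : S = (S ∩ {c'}) ∪ (S ∩ Ioc c' d) := by
    ext q
    have : q ∈ S → c' ≤ q ∧ q ≤ d := fun hq => hq.2.1
    simp only [mem_union, mem_inter_iff, mem_singleton_iff, mem_Ioc]
    constructor
    · intro hq
      rcases (this hq).1.eq_or_lt with h1 | h1
      · exact Or.inl ⟨hq, h1.symm⟩
      · exact Or.inr ⟨hq, h1, (this hq).2⟩
    · rintro (hq | hq) <;> exact hq.1
  have h0 : bvMeasure (ordPart u) c' d (S ∩ {c'}) = 0 := by
    by_cases hcS : c' ∈ S
    · rw [inter_eq_right.2 (singleton_subset_iff.2 hcS)]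
      exact h.bvMeasure_singleton_eq_zero hΩ' hcS.2.1 hcS.2.2
    · rw [inter_singleton_eq_empty.2 hcS, VectorMeasure.empty]
  have h1 : bvMeasure (ordPart u) c' d S = bvMeasure (ordPart u) c d (S ∩ Ioc c' d) := by
    have he := DFunLike.congr_fun (h.bvMeasure_restrict_Ioc_eq hc hcd hΩ) S
    rw [VectorMeasure.restrict_apply _ measurableSet_Ioc hSm,
      VectorMeasure.restrict_apply _ measurableSet_Ioc hSm] at he
    rw [← he]
    conv_lhs => rw [hsplit]
    rw [VectorMeasure.of_union _ (hSm.inter (measurableSet_singleton _))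
      (hSm.inter measurableSet_Ioc), h0, zero_add]
    rw [Set.disjoint_left]
    rintro q ⟨_, hq⟩ ⟨_, hq'⟩
    exact hq'.1.ne' hq
  rw [h1]
  refine (VectorMeasure.enorm_measure_le_variation _ _).trans ?_
  unfold contVar
  rw [Measure.restrict_apply hE]
  refine measure_mono fun q hq => ⟨hq.1.1, ⟨⟨hc.trans hq.1.2.1.1, hq.1.2.1.2⟩, hq.1.2.2⟩⟩

lemma varMeasure_mono (h : IsSBVLoc Ω u) (hc : c ≤ c') (hcd : c' ≤ d) (hΩ : Icc c d ⊆ Ω) :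
    varMeasure u c' d ≤ varMeasure u c d := by
  refine add_le_add (h.contVar_mono hc hcd hΩ) (Measure.le_iff.2 fun A hA => ?_)
  rw [Measure.sum_apply _ hA, Measure.sum_apply _ hA]
  exact ENNReal.tsum_mono_subtype (fun τ : ℝ =>
    (ENNReal.ofReal (∫ s in (-1 / 2 : ℝ)..(1 / 2), |deriv (u τ) s|) • Measure.dirac τ) A)
    (inter_subset_inter_right _ (Icc_subset_Icc_left hc))

lemma varMeasure_real_Icc_mono (h : IsSBVLoc Ω u) (hc : c ≤ c') (hcd : c' ≤ d)
    (hΩ : Icc c d ⊆ Ω) :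
    (varMeasure u c' d).real (Icc c' d) ≤ (varMeasure u c d).real (Icc c d) := by
  have := h.isFiniteMeasure_varMeasure hΩ
  exact ENNReal.toReal_mono (measure_ne_top _ _)
    ((h.varMeasure_mono hc hcd hΩ _).trans (measure_mono (Icc_subset_Icc_left hc)))

end IsSBVLoc

/-! ### Growth of the distance to the equilibrium and to a ball. -/

section Stability

variable {n : ℕ} {D : Set (EuclideanSpace ℝ (Fin n))}
  {f : EuclideanSpace ℝ (Fin n) → EuclideanSpace ℝ (Fin n)}
  {g : EuclideanSpace ℝ (Fin n) → Matrix (Fin n) (Fin n) ℝ} {I Ω : Set ℝ} {u x : DynVec n}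
  {xstar : EuclideanSpace ℝ (Fin n)} {c d : ℝ}

lemma sum_div_norm_mul_le (v z : EuclideanSpace ℝ (Fin n)) :
    ∑ i, v i / ‖v‖ * z i ≤ ‖z‖ := by
  rcases eq_or_ne v 0 with rfl | hv
  · simp
  have h1 := real_inner_le_norm v z
  have h2 : inner ℝ v z = ∑ i, v i * z i := by
    simp [PiLp.inner_apply, mul_comm]
  have h3 : ∑ i, v i / ‖v‖ * z i = (∑ i, v i * z i) / ‖v‖ := by
    rw [Finset.sum_div]
    exact Finset.sum_congr rfl fun i _ => by ring
  rw [h3, ← h2, div_le_iff₀' (norm_pos_iff.2 hv)]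
  exact h1

lemma sum_div_norm_mul_self (v : EuclideanSpace ℝ (Fin n)) :
    ∑ i, v i / ‖v‖ * v i = ‖v‖ := by
  rcases eq_or_ne v 0 with rfl | hv
  · simp
  have h2 : inner ℝ v v = ∑ i, v i * v i := by
    rw [PiLp.inner_apply]
    simp only [RCLike.inner_apply, conj_trivial]
  have h3 : ∑ i, v i / ‖v‖ * v i = (∑ i, v i * v i) / ‖v‖ := by
    rw [Finset.sum_div]
    exact Finset.sum_congr rfl fun i _ => by ring
  rw [h3, ← h2, real_inner_self_eq_norm_mul_norm, mul_div_assoc, div_self (norm_ne_zero_iff.2 hv),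
    mul_one]

lemma abs_div_norm_le_one (v : EuclideanSpace ℝ (Fin n)) (i : Fin n) : |v i / ‖v‖| ≤ 1 := by
  rw [abs_div, abs_norm]
  exact div_le_one_of_le₀ (abs_apply_le_norm v i) (norm_nonneg _)

/-- The convexity inequality for the norm, with subgradient `v / ‖v‖`; for `v = 0` division by zero
makes the right-hand side zero and the inequality still holds. -/
lemma norm_sub_norm_le_sum (v z : EuclideanSpace ℝ (Fin n)) :
    ‖v‖ - ‖z‖ ≤ ∑ i, v i / ‖v‖ * (v i - z i) := by
  have h1 := sum_div_norm_mul_le v z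
  have h2 := sum_div_norm_mul_self v
  simp only [mul_sub, Finset.sum_sub_distrib]
  linarith

/-- Growth of the distance of a solution from an equilibrium. -/
lemma IsSolution.norm_sub_le_mul_exp (hcd : c ≤ d) {K : ℝ≥0} (hf : LipschitzOnWith K f D)
    (hg : ∀ i j, LipschitzOnWith K (fun y => g y i j) D) (hu : ∀ j, IsSBVLoc I (comp u j))
    (hI : Icc c d ⊆ I) (hx : IsSolution D f g u Ω x) (hΩ : Icc c d ⊆ Ω)
    (hstar : IsEquilibrium D f g u I xstar) {t : ℝ} (ht : t ∈ Icc c d) {s : ℝ} (hs : s ∈ J) :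
    ‖x t s - xstar‖ ≤ ‖x c (-1 / 2) - xstar‖ * Real.exp (n * K * totFun u c d t s) := by
  refine hx.le_mul_exp hcd hf hg hu hI hΩ (w := fun z => ‖z - xstar‖)
    (fun _ => norm_nonneg _) (fun y z => ?_) (fun t₁ ht₁ s₁ hs₁ t₂ ht₂ s₂ hs₂ hle => ?_) ht hs
  · refine (abs_norm_sub_norm_le _ _).trans (le_of_eq ?_)
    rw [sub_sub_sub_cancel_right]
  · refine Or.inr ⟨xstar, hstar.1, fun i => (x t₂ s₂ - xstar) i / ‖x t₂ s₂ - xstar‖,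
      abs_div_norm_le_one _, le_rfl, ?_, ?_⟩
    · refine (norm_sub_norm_le_sum _ _).trans (le_of_eq (Finset.sum_congr rfl fun i _ => ?_))
      simp
    · refine le_of_eq (Finset.sum_eq_zero fun i _ => ?_)
      -- The constant function `xstar` is a solution with zero increments, so its right-hand side
      -- vanishes on every dynamic interval.
      have := hstar.2.sub_eq_rhs hI ht₁ hs₁ ht₂ hs₂ i
      rw [← this, sub_self, mul_zero]

/-- Growth of the distance of a solution from a ball on whose boundary the right-hand side does
not point outwards. -/
lemma IsSolution.max_norm_sub_le_mul_exp (hcd : c ≤ d) {K : ℝ≥0} (hf : LipschitzOnWith K f D)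
    (hg : ∀ i j, LipschitzOnWith K (fun y => g y i j) D) (hu : ∀ j, IsSBVLoc I (comp u j))
    (hI : Icc c d ⊆ I) (hx : IsSolution D f g u Ω x) (hΩ : Icc c d ⊆ Ω) {r : ℝ} (hr : 0 < r)
    (hball : Metric.closedBall xstar r ⊆ D) {S : Set ℝ} (hS : Icc c d ⊆ S)
    (hsphere : ∀ y ∈ D, ‖y - xstar‖ = r →
      NonposIn S (∑ i, (y i - xstar i) • rhs f g u (fun _ _ => y) i))
    {t : ℝ} (ht : t ∈ Icc c d) {s : ℝ} (hs : s ∈ J) :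
    max (‖x t s - xstar‖ - r) 0 ≤
      max (‖x c (-1 / 2) - xstar‖ - r) 0 * Real.exp (n * K * totFun u c d t s) := by
  refine hx.le_mul_exp hcd hf hg hu hI hΩ (w := fun z => max (‖z - xstar‖ - r) 0)
    (fun _ => le_max_right _ _) (fun y z => ?_) (fun t₁ ht₁ s₁ hs₁ t₂ ht₂ s₂ hs₂ hle => ?_) ht hs
  · refine (abs_max_sub_max_le_abs _ _ _).trans ?_
    rw [sub_sub_sub_cancel_right]
    refine (abs_norm_sub_norm_le _ _).trans (le_of_eq ?_)
    rw [sub_sub_sub_cancel_right]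
  rcases le_or_gt ‖x t₂ s₂ - xstar‖ r with h | h
  · exact Or.inl (max_eq_right (sub_nonpos.2 h))
  set v := x t₂ s₂ - xstar with hv
  have hv0 : 0 < ‖v‖ := hr.trans h
  have hyn : ‖(xstar + (r / ‖v‖) • v) - xstar‖ = r := by
    rw [add_sub_cancel_left, norm_smul, Real.norm_eq_abs, abs_of_pos (div_pos hr hv0),
      div_mul_cancel₀ _ hv0.ne']
  have hyD : xstar + (r / ‖v‖) • v ∈ D :=
    hball (by rw [Metric.mem_closedBall, dist_eq_norm, hyn])
  have hw2 : max (‖v‖ - r) 0 = ‖v‖ - r := max_eq_left (sub_nonneg.2 h.le)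
  -- The frozen point is the radial projection of the later endpoint onto the sphere; its distance
  -- from that endpoint is exactly `w`.
  refine Or.inr ⟨xstar + (r / ‖v‖) • v, hyD, fun i => v i / ‖v‖, abs_div_norm_le_one _,
    ?_, ?_, ?_⟩
  · have h1 : x t₂ s₂ - (xstar + (r / ‖v‖) • v) = (1 - r / ‖v‖) • v := by
      rw [sub_smul, one_smul, ← sub_sub]
    have h2 : 0 ≤ 1 - r / ‖v‖ := sub_nonneg.2 ((div_le_one hv0).2 h.le)
    rw [hw2, h1, norm_smul, Real.norm_eq_abs, abs_of_nonneg h2, sub_mul, one_mul,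
      div_mul_cancel₀ _ hv0.ne']
  · rw [hw2]
    have h1 := norm_sub_norm_le_sum v (x t₁ s₁ - xstar)
    have h2 : ∑ i, v i / ‖v‖ * (v i - (x t₁ s₁ - xstar) i) =
        ∑ i, v i / ‖v‖ * (x t₂ s₂ i - x t₁ s₁ i) :=
      Finset.sum_congr rfl fun i _ => by simp [hv]
    have h3 := le_max_left (‖x t₁ s₁ - xstar‖ - r) 0
    linarith
  · have h1 := hsphere _ hyD hyn c d _ hS
      ((isTest_step ht₂ s₂).sub (isTest_step ht₁ s₁))
      (fun t s _ => sub_nonneg.2 (step_mono c hle t s))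
    rw [Finset.sum_apply, Finset.sum_apply, Finset.sum_apply] at h1
    -- The sign condition is in the direction `y - xstar`, which is `r` times the unit vector used
    -- here.
    have h2 : ∀ i, ((xstar + (r / ‖v‖) • v) i - xstar i) = r * (v i / ‖v‖) := by
      intro i
      simp only [PiLp.add_apply, PiLp.smul_apply, smul_eq_mul, add_sub_cancel_left]
      ring
    simp only [Pi.smul_apply, smul_eq_mul, h2, mul_assoc] at h1
    rw [← Finset.mul_sum] at h1
    exact nonpos_of_mul_nonpos_right h1 hr

lemma IsSolution.tendsto_right (hx : IsSolution D f g u Ω x) {t : ℝ} (ht : t ∈ Ω) :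
    Tendsto (fun t' => x t' (-1 / 2)) (𝓝[>] t) (𝓝 (x t (1 / 2))) := by
  have h1 : Tendsto (fun t' => fun i => x t' (-1 / 2) i) (𝓝[>] t) (𝓝 fun i => x t (1 / 2) i) :=
    tendsto_pi_nhds.2 fun i => ((hx.sbv i).rightLim t ht).tendsto neg_half_mem_J
  exact ((PiLp.continuous_toLp 2 _).tendsto _).comp h1

/-- A ball on whose boundary the right-hand side does not point outwards after the time `c` is
viable after a possible jump at `c`. -/
lemma IsSolution.norm_sub_le_of_right (hcd : c < d) {K : ℝ≥0} (hf : LipschitzOnWith K f D)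
    (hg : ∀ i j, LipschitzOnWith K (fun y => g y i j) D) (hu : ∀ j, IsSBVLoc I (comp u j))
    (hI : Icc c d ⊆ I) (hx : IsSolution D f g u Ω x) (hΩ : Icc c d ⊆ Ω) {r : ℝ} (hr : 0 < r)
    (hball : Metric.closedBall xstar r ⊆ D) {S : Set ℝ} (hS : Ioc c d ⊆ S)
    (hsphere : ∀ y ∈ D, ‖y - xstar‖ = r →
      NonposIn S (∑ i, (y i - xstar i) • rhs f g u (fun _ _ => y) i))
    (h0 : ‖x c (1 / 2) - xstar‖ ≤ r) {s : ℝ} (hs : s ∈ J) : ‖x d s - xstar‖ ≤ r := by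
  set B := (d - c) + ∑ j, (varMeasure (comp u j) c d).real (Icc c d) with hB
  -- The interval `[t', d]` and its mass change with `t'`; the exponent `B` of the whole interval
  -- `[c, d]` bounds them uniformly, so that the limit can be taken.
  have hev : ∀ᶠ t' in 𝓝[>] c, max (‖x d s - xstar‖ - r) 0 ≤
      max (‖x t' (-1 / 2) - xstar‖ - r) 0 * Real.exp (n * K * B) := by
    filter_upwards [Ioo_mem_nhdsGT hcd] with t' ht'
    have hsub : Icc t' d ⊆ Icc c d := Icc_subset_Icc_left ht'.1.le
    have hd : d ∈ Icc t' d := ⟨ht'.2.le, le_rfl⟩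
    refine (hx.max_norm_sub_le_mul_exp ht'.2.le hf hg hu (hsub.trans hI) (hsub.trans hΩ) hr hball
      (S := S) (fun q hq => hS ⟨ht'.1.trans_le hq.1, hq.2⟩) hsphere hd hs).trans ?_
    refine mul_le_mul_of_nonneg_left (Real.exp_le_exp.2 (mul_le_mul_of_nonneg_left ?_
      (by positivity))) (le_max_right _ _)
    refine (totFun_le hu (hsub.trans hI) hd hs).trans (add_le_add
      (sub_le_sub_left ht'.1.le d) (Finset.sum_le_sum fun j _ => ?_))
    exact (hu j).varMeasure_real_Icc_mono ht'.1.le ht'.2.le hI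
  have hlim : Tendsto (fun t' => max (‖x t' (-1 / 2) - xstar‖ - r) 0 * Real.exp (n * K * B))
      (𝓝[>] c) (𝓝 (max (‖x c (1 / 2) - xstar‖ - r) 0 * Real.exp (n * K * B))) := by
    have h1 := ((hx.tendsto_right (hΩ ⟨le_rfl, hcd.le⟩)).sub_const xstar).norm.sub_const r
    exact (h1.max tendsto_const_nhds).mul_const _
  have h1 := ge_of_tendsto hlim hev
  rw [max_eq_right (sub_nonpos.2 h0), zero_mul] at h1
  exact sub_nonpos.1 ((le_max_left _ _).trans h1)

end Stability

end DynDist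

end

/-! ### Uniform stability. -/

theorem theorem7 {n : ℕ} (D : Set (EuclideanSpace ℝ (Fin n))) (hD : IsOpen D)
    (f : EuclideanSpace ℝ (Fin n) → EuclideanSpace ℝ (Fin n))
    (g : EuclideanSpace ℝ (Fin n) → Matrix (Fin n) (Fin n) ℝ)
    (hf : ∃ K : ℝ≥0, LipschitzOnWith K f D)
    (hg : ∃ K : ℝ≥0, ∀ i j, LipschitzOnWith K (fun x => g x i j) D)
    (a T : EReal) (haT : a ≤ T)
    (u : DynDist.DynVec n) (hu : ∀ j, DynDist.IsSBVLoc (DynDist.openRay a) (DynDist.comp u j))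
    (xstar : EuclideanSpace ℝ (Fin n))
    (hxstar : DynDist.IsEquilibrium D f g u (DynDist.openRay a) xstar)
    (hsphere : ∀ l : ℕ, 1 ≤ l → ∀ y ∈ D, ‖y - xstar‖ = 1 / (l : ℝ) →
      DynDist.NonposIn (DynDist.openRay T)
        (∑ i, (y i - xstar i) • DynDist.rhs f g u (fun _ _ => y) i)) :
    DynDist.IsUniformlyStable D f g u (DynDist.openRay a) (DynDist.closedRay T) xstar := by
  obtain ⟨K₁, hf⟩ := hf
  obtain ⟨K₂, hg⟩ := hg
  obtain ⟨K, hf, hg⟩ : ∃ K : ℝ≥0, LipschitzOnWith K f D ∧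
      ∀ i j, LipschitzOnWith K (fun x => g x i j) D :=
    ⟨max K₁ K₂, hf.weaken (le_max_left _ _), fun i j => (hg i j).weaken (le_max_right _ _)⟩
  obtain ⟨ε, hε, hεD⟩ := Metric.isOpen_iff.1 hD xstar hxstar.1
  -- Shifting the index by `m + 1` puts all the balls inside `D` while keeping their radii
  -- reciprocals of integers, where the sign condition is available.
  obtain ⟨m, hm⟩ := exists_nat_one_div_lt hε
  have hpos : ∀ k : ℕ, (0 : ℝ) < 1 / ((m + 1 + k : ℕ) : ℝ) := fun k => by positivity
  have hanti : ∀ {k l : ℕ}, k ≤ l → (1 : ℝ) / ((m + 1 + l : ℕ) : ℝ) ≤ 1 / ((m + 1 + k : ℕ) : ℝ) :=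
    fun {k l} hkl => one_div_le_one_div_of_le (by positivity) (by exact_mod_cast by omega)
  have hball : ∀ k : ℕ, Metric.closedBall xstar (1 / ((m + 1 + k : ℕ) : ℝ)) ⊆ D := by
    intro k
    refine (Metric.closedBall_subset_ball ?_).trans hεD
    refine (hanti (Nat.zero_le k)).trans_lt ?_
    simpa using hm
  refine ⟨fun k => Metric.closedBall xstar (1 / ((m + 1 + k : ℕ) : ℝ)), fun k =>
    ⟨Metric.isClosed_closedBall, Metric.closedBall_subset_closedBall (hanti (Nat.le_succ k)),
      hball k, Metric.closedBall_mem_nhds _ (hpos k)⟩, fun U hU => ?_, fun l => ?_⟩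
  · obtain ⟨δ, hδ, hδU⟩ := Metric.mem_nhds_iff.1 hU
    obtain ⟨k, hk⟩ := exists_nat_one_div_lt hδ
    refine ⟨k, (Metric.closedBall_subset_ball ?_).trans hδU⟩
    refine lt_of_le_of_lt (one_div_le_one_div_of_le (by positivity) ?_) hk
    push_cast
    linarith [(Nat.cast_nonneg m : (0 : ℝ) ≤ m)]
  -- The expansion factor of a possible jump at `T`. On the degenerate interval the `dt` part is
  -- zero. For infinite `T` the value of `T.toReal` is meaningless, but then `t₀ = T` cannot occur
  -- and the bound is not needed.
  set E := Real.exp (n * K * ∑ j,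
    (DynDist.varMeasure (DynDist.comp u j) T.toReal T.toReal).real (Icc T.toReal T.toReal)) with hE
  obtain ⟨k, hk⟩ := exists_nat_ge (E * ((m + 1 + l : ℕ) : ℝ))
  have hkl : (1 : ℝ) / ((m + 1 + max k l : ℕ) : ℝ) * E ≤ 1 / ((m + 1 + l : ℕ) : ℝ) := by
    rw [div_mul_eq_mul_div, one_mul, div_le_div_iff₀ (by positivity) (by positivity), one_mul]
    refine hk.trans ?_
    exact_mod_cast (le_max_left k l).trans (Nat.le_add_left _ _)
  refine ⟨max k l, le_max_right _ _, fun t₀ ht₀ Ω x _ hord hΩI ht₀Ω hx hx₀ => ?_⟩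
  have hx₀l := Metric.closedBall_subset_closedBall (hanti (le_max_right k l)) hx₀
  refine ⟨hx₀l, fun t ht ht₀t s hs => ?_⟩
  simp only [Metric.mem_closedBall, dist_eq_norm] at hx₀ hx₀l ⊢
  have hIcc : Icc t₀ t ⊆ Ω := hord.out ht₀Ω ht
  have htm : t ∈ Icc t₀ t := ⟨ht₀t, le_rfl⟩
  have hsph := hsphere (m + 1 + l) (by omega)
  -- For `t₀ > T` the ball of index `l` is itself viable; the smaller ball is needed only for `t₀ =
  -- T`.
  rcases (show T ≤ (t₀ : EReal) from ht₀).lt_or_eq with hT | hT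
  · have h1 := hx.max_norm_sub_le_mul_exp ht₀t hf hg hu (hIcc.trans hΩI) hIcc (hpos l) (hball l)
      (S := DynDist.openRay T) (fun q hq => hT.trans_le (EReal.coe_le_coe_iff.2 hq.1)) hsph htm hs
    rw [max_eq_right (sub_nonpos.2 hx₀l), zero_mul] at h1
    exact sub_nonpos.1 ((le_max_left _ _).trans h1)
  have hT' : T.toReal = t₀ := by rw [hT, EReal.toReal_coe]
  have hjump : ∀ s ∈ DynDist.J, ‖x t₀ s - xstar‖ ≤ 1 / ((m + 1 + l : ℕ) : ℝ) := by
    intro s hs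
    have hsub : Icc t₀ t₀ ⊆ Ω := by simpa using ht₀Ω
    have hself : t₀ ∈ Icc t₀ t₀ := ⟨le_rfl, le_rfl⟩
    refine (hx.norm_sub_le_mul_exp le_rfl hf hg hu (hsub.trans hΩI) hsub hxstar hself hs).trans
      (le_trans ?_ hkl)
    refine mul_le_mul hx₀ (Real.exp_le_exp.2 (mul_le_mul_of_nonneg_left ?_ (by positivity)))
      (Real.exp_pos _).le (hpos _).le
    have h1 := DynDist.totFun_le hu (hsub.trans hΩI) hself hs
    rw [sub_self, zero_add] at h1
    rwa [hT']
  rcases ht₀t.eq_or_lt with rfl | hlt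
  · exact hjump s hs
  · refine hx.norm_sub_le_of_right hlt hf hg hu (hIcc.trans hΩI) hIcc (hpos l) (hball l)
      (S := DynDist.openRay T) (fun q hq => ?_) hsph (hjump _ DynDist.half_mem_J) hs
    change T < (q : EReal)
    rw [hT]
    exact EReal.coe_lt_coe_iff.2 hq.1
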